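/- **Setting.** Let $\mathbb H^2=\{z\in\mathbb C:\operatorname{Im}z>0\}$ and let $\widetilde M_2=\{(z_1,z_2)\in\mathbb H^2\times\mathbb H^2: z_1\ne z_2\}$, with the complex structure of $\mathbb C^2$. The group $PL(2,\mathbb R)=SL(2,\mathbb R)/\{\pm\mathbb I_2\}$ acts on $\widetilde M_2$ by $M\odot(z_1,z_2)=(M\odot z_1,M\odot z_2)$, where $M\odot z=\frac{az+b}{cz+d}$ for $M=\begin{pmatrix}a&b\\c&d\end{pmatrix}$. Let $P(z_1,z_2)=(z_2,z_1)$ and $G=PL(2,\mathbb R)\times\{\mathrm{Id},P\}$. The map $(s,M)\mapsto M\odot w_s$, $w_s=(ie^{s/2},ie^{-s/2})$, identifies $(0,\infty)\times PL(2,\mathbb R)$ with $\widetilde M_2$. Let $e_1,e_2,e_3$ be the left-invariant vector fields on $PL(2,\mathbb R)$ which at the identity are $$e_1=\begin{pmatrix}0&1\\1&0\end{pmatrix},\quad e_2=\begin{pmatrix}0&1\\-1&0\end{pmatrix},\quad e_3=\begin{pmatrix}1&0\\0&-1\end{pmatrix},$$ and let $ds,\sigma_1,\sigma_2,\sigma_3$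 be the coframe on $\widetilde M_2$ dual to the frame $\partial/\partial s,e_1,e_2,e_3$. Say that a symmetric 2-tensor $T$ on $\widetilde M_2$ is *generated by* a function $B:(0,\infty)\to\mathbb R$ if $T=B_1\,ds^2+B_2\,\sigma_1^2+B_3\,\sigma_2^2+B_4\,\sigma_3^2$, where $$B_1=\frac{1}{8\sinh(s/2)}\frac{d}{ds}\Bigl(\frac{B(s)}{\cosh(s/2)}\Bigr),\quad B_2=B(s),\quad B_3=2\sinh(s/2)\frac{d}{ds}\Bigl(\frac{B(s)}{\cosh(s/2)}\Bigr),\quad B_4=\frac{B(s)}{\cosh^2(s/2)}.$$ **Proposition 3.3.** Let $\tilde\gamma$ be a $G$-invariant Kähler metric on $\widetilde M_2$. Then $\tilde\gamma$ is generated by a smooth function $A:(0,\infty)\to\mathbb R$. Moreover, whenever $\tilde\gamma$ is generated by $A$, with coefficients $A_1,\dots,A_4$, the Ricci tensor of $\tilde\gamma$ is generated by the function $$C(s)=-4\sinh(s/2)\cosh(s/2)\,\frac{d}{ds}\log\Bigl(\frac{A_1A_2}{\cosh^2(s/2)}\Bigr)-8\cosh^2(s/2),$$ and its coefficients $C_1,\dots,C_4$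 are smooth functions on $(0,\infty)$. -/

import Mathlib

open scoped ContDiff

noncomputable section

/-- The ambient real vector space `ℂ × ℂ` of the global coordinates `(z₁, z₂)`; its complex
structure is `v ↦ Complex.I • v`. -/
abbrev CC : Type := ℂ × ℂ

/-- A (not necessarily symmetric) covariant 2-tensor at a point. -/
abbrev Bilin : Type := CC →L[ℝ] CC →L[ℝ] ℝ

/-- The space of ordered pairs of distinct points of the upper half plane
(an open subset of `ℂ × ℂ`). -/
def pairSpace : Set CC := {p | 0 < p.1.im ∧ 0 < p.2.im ∧ p.1 ≠ p.2}

/-! ### The group action -/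

/-- The fractional linear map `z ↦ (a z + b) / (c z + d)`. -/
def moebius (N : Matrix (Fin 2) (Fin 2) ℝ) (z : ℂ) : ℂ :=
  ((N 0 0 : ℂ) * z + (N 0 1 : ℂ)) / ((N 1 0 : ℂ) * z + (N 1 1 : ℂ))

/-- The diagonal action `(z₁, z₂) ↦ (N ⊙ z₁, N ⊙ z₂)`. -/
def pairAct (N : Matrix (Fin 2) (Fin 2) ℝ) (p : CC) : CC := (moebius N p.1, moebius N p.2)

/-- Invariance of a 2-tensor field under (the pullback by) a map `φ` of the pair space. -/
def InvariantUnder (φ : CC → CC) (T : CC → Bilin) : Prop :=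
  ∀ p ∈ pairSpace, ∀ u v : CC, T (φ p) (fderiv ℝ φ p u) (fderiv ℝ φ p v) = T p u v

/-- Invariance under `PL(2, ℝ) × {Id, P}`, where `PL(2, ℝ) = SL(2, ℝ) / {± 1}` acts diagonally
by fractional linear maps, and `P` swaps the two points. -/
structure IsGInvariant (T : CC → Bilin) : Prop where
  moebius : ∀ M : Matrix.SpecialLinearGroup (Fin 2) ℝ,
    InvariantUnder (pairAct (M : Matrix (Fin 2) (Fin 2) ℝ)) T
  swap : InvariantUnder Prod.swap T

/-! ### Kähler metrics -/

/-- Smooth Riemannian metrics on the pair space. -/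
structure IsRiemannianMetric (γ : CC → Bilin) : Prop where
  smooth : ContDiffOn ℝ ∞ γ pairSpace
  symm : ∀ p ∈ pairSpace, ∀ u v : CC, γ p u v = γ p v u
  pos : ∀ p ∈ pairSpace, ∀ u : CC, u ≠ 0 → 0 < γ p u u

/-- The form `ω(X, Y) = γ(J X, Y)`. -/
def kahlerForm (γ : CC → Bilin) (p : CC) (u v : CC) : ℝ := γ p (Complex.I • u) v

/-- Kähler metrics on the pair space: Hermitian Riemannian metrics with `dω = 0`. The exterior
derivative is written out on three constant vector fields `u`, `v`, `w`. -/
structure IsKahlerMetric (γ : CC → Bilin) : Prop extends IsRiemannianMetric γ where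
  hermitian : ∀ p ∈ pairSpace, ∀ u v : CC, γ p (Complex.I • u) (Complex.I • v) = γ p u v
  closed : ∀ p ∈ pairSpace, ∀ u v w : CC,
    fderiv ℝ (fun q => kahlerForm γ q v w) p u
      + fderiv ℝ (fun q => kahlerForm γ q w u) p v
      + fderiv ℝ (fun q => kahlerForm γ q u v) p w = 0

/-! ### The Ricci tensor, in the global real coordinates `(x₁, y₁, x₂, y₂)` -/

/-- The coordinate vector fields `∂/∂x₁, ∂/∂y₁, ∂/∂x₂, ∂/∂y₂`. -/
def coordVec : Fin 4 → CC := ![(1, 0), (Complex.I, 0), (0, 1), (0, Complex.I)]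

/-- The coordinates `(x₁, y₁, x₂, y₂)` of a vector. -/
def coords (v : CC) : Fin 4 → ℝ := ![v.1.re, v.1.im, v.2.re, v.2.im]

/-- Partial derivative `∂ᵢ f`. -/
def pderiv (i : Fin 4) (f : CC → ℝ) (p : CC) : ℝ := fderiv ℝ f p (coordVec i)

/-- The matrix `(γᵢⱼ)` of the metric. -/
def gram (γ : CC → Bilin) (p : CC) : Matrix (Fin 4) (Fin 4) ℝ :=
  Matrix.of fun i j => γ p (coordVec i) (coordVec j)

/-- Christoffel symbols `Γᵏᵢⱼ = ½ ∑ₗ γᵏˡ (∂ᵢ γⱼₗ + ∂ⱼ γᵢₗ - ∂ₗ γᵢⱼ)` of the Levi-Civita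
connection. -/
def christoffel (γ : CC → Bilin) (k i j : Fin 4) (p : CC) : ℝ :=
  (1 / 2) * ∑ l, (gram γ p)⁻¹ k l *
    (pderiv i (fun q => gram γ q j l) p + pderiv j (fun q => gram γ q i l) p
      - pderiv l (fun q => gram γ q i j) p)

/-- The Riemann tensor
`Rˡₖᵢⱼ = ∂ᵢ Γˡⱼₖ - ∂ⱼ Γˡᵢₖ + ∑ₘ (Γˡᵢₘ Γᵐⱼₖ - Γˡⱼₘ Γᵐᵢₖ)`, that is
`R(∂ᵢ, ∂ⱼ) ∂ₖ = ∑ₗ Rˡₖᵢⱼ ∂ₗ` with `R(X, Y) = [∇_X, ∇_Y] - ∇_[X, Y]`. -/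
def riemann (γ : CC → Bilin) (l k i j : Fin 4) (p : CC) : ℝ :=
  pderiv i (christoffel γ l j k) p - pderiv j (christoffel γ l i k) p
    + ∑ m, (christoffel γ l i m p * christoffel γ m j k p
      - christoffel γ l j m p * christoffel γ m i k p)

/-- The Ricci tensor `Ric(u, v) = tr (X ↦ R(X, u) v)`. -/
def ricci (γ : CC → Bilin) (p : CC) (u v : CC) : ℝ :=
  ∑ j, ∑ k, (∑ i, riemann γ i k i j p) * coords u j * coords v k

/-! ### The frame `∂/∂s, e₁, e₂, e₃` -/

/-- The representative `w_s = (i e^{s/2}, i e^{-s/2})` of the orbit of pairs of points at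
hyperbolic distance `s` (curvature `-1`). -/
def basePoint (s : ℝ) : CC :=
  (Complex.I * (Real.exp (s / 2) : ℂ), Complex.I * (Real.exp (-s / 2) : ℂ))

/-- The basis `e₁, e₂, e₃` of the Lie algebra of `PL(2, ℝ)` (indexed by `0, 1, 2`). -/
def lieBasis : Fin 3 → Matrix (Fin 2) (Fin 2) ℝ :=
  ![!![0, 1; 1, 0], !![0, 1; -1, 0], !![1, 0; 0, -1]]

/-- The frame on the pair space, at the point `M ⊙ w_s`. Under the identification
`(s, M) ↦ M ⊙ w_s` of `(0, ∞) × PL(2, ℝ)` with the pair space, index `0` is `∂/∂s` and index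
`k = 1, 2, 3` is the left-invariant vector field on `PL(2, ℝ)` which is `e_k` at the identity. -/
def frame (s : ℝ) (M : Matrix.SpecialLinearGroup (Fin 2) ℝ) : Fin 4 → CC :=
  Fin.cons (deriv (fun r : ℝ => pairAct (M : Matrix (Fin 2) (Fin 2) ℝ) (basePoint r)) s)
    fun k => deriv (fun t : ℝ =>
      pairAct ((M : Matrix (Fin 2) (Fin 2) ℝ) * NormedSpace.exp (t • lieBasis k))
        (basePoint s)) 0

/-- `T = B₀(s) ds² + B₁(s) σ₁² + B₂(s) σ₂² + B₃(s) σ₃²` on the whole pair space, where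
`ds, σ₁, σ₂, σ₃` is the coframe dual to the frame `∂/∂s, e₁, e₂, e₃`; so the coframe reads off the
components `a`, `b` of tangent vectors with respect to that frame. -/
def HasDiagonalForm (T : CC → CC → CC → ℝ) (B : Fin 4 → ℝ → ℝ) : Prop :=
  ∀ s : ℝ, 0 < s → ∀ M : Matrix.SpecialLinearGroup (Fin 2) ℝ, ∀ a b : Fin 4 → ℝ,
    T (pairAct (M : Matrix (Fin 2) (Fin 2) ℝ) (basePoint s))
      (∑ i, a i • frame s M i) (∑ i, b i • frame s M i) = ∑ i, B i s * (a i * b i)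

/-- The four coefficients (of `ds², σ₁², σ₂², σ₃²`) generated by a single function `A`. -/
def coeffs (A : ℝ → ℝ) : Fin 4 → ℝ → ℝ :=
  ![fun s => 1 / (8 * Real.sinh (s / 2)) * deriv (fun r => A r / Real.cosh (r / 2)) s,
    A,
    fun s => 2 * Real.sinh (s / 2) * deriv (fun r => A r / Real.cosh (r / 2)) s,
    fun s => A s / Real.cosh (s / 2) ^ 2]

end

/-! Every orbit of the action meets the curve `w_s` (`exists_pairAct_basePoint`), so an invariant
tensor is determined by its values on the frame at `w_s`.

Shape of the metric. The swap composed with `z ↦ -1/z` fixes `w_s` and acts on the frame with signs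
`+,-,+,-`, which separates `∂/∂s, e₂` from `e₁, e₃`. The complex structure satisfies `J e₁ =
cosh(s/2) e₃` and `J e₂ = -4 sinh(s/2) ∂/∂s`, so hermitian symmetry kills the other cross terms and
leaves two free coefficients (`IsKahlerMetric.baseFrame_apply`). The equation `dω = 0` links these
two by a first-order ODE (`IsKahlerMetric.hasDerivAt_apply_div_cosh`), and a single function `A`
remains.

Ricci tensor. For a Kähler metric, `Ric(u, v) = -¼ (H(u, v) + H(Ju, Jv))`, with `H` the coordinate
Hessian of `log det γ` (`trace_curvatureEndo`, `IsKahlerMetric.ricci_eq`). By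
`IsGInvariant.det_gram`, `log det γ = Φ(ℓ) - 4 log y₁ - 4 log y₂`, where `ℓ = log(|z₁ - z₂|²/(y₁
y₂))` equals `log(4 sinh²(s/2))` on the orbit of `w_s`. Up to `-log y₁ - log y₂`, `ℓ` is the real
part of a locally defined holomorphic function, so the `J`-invariant part of its Hessian is the
product hyperbolic metric `h`, and `Ric = -¼ (Φ''(ℓ) (dℓ² + (dℓ∘J)²) + (Φ'(ℓ) + 4) h)`
(`hessian_radial`). In the frame, `dℓ`, `dℓ∘J` and `h` are explicit; the `σ₁²` coefficient is `C`,
and the others are those generated by `C` (`coeffs_eq_of_eq`). -/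

set_option maxSynthPendingDepth 3

noncomputable section

/-! ### Pointwise algebra of the curvature of a Kähler connection. -/

section ComplexBilinearConnection

variable {V : Type*} [NormedAddCommGroup V] [NormedSpace ℝ V]

/-- The curvature `R(X, Y) Z` of the connection with Christoffel tensor `Γ`, whose derivative at
the given point is `Γ'`. -/
def curvature (Γ : V →L[ℝ] V →L[ℝ] V) (Γ' : V →L[ℝ] V →L[ℝ] V →L[ℝ] V) (X Y Z : V) : V :=
  Γ' X Y Z - Γ' Y X Z + Γ X (Γ Y Z) - Γ Y (Γ X Z)

/-- The endomorphism `X ↦ R(X, u) v`, whose trace is the Ricci tensor. -/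
def curvatureEndo (Γ : V →L[ℝ] V →L[ℝ] V) (Γ' : V →L[ℝ] V →L[ℝ] V →L[ℝ] V) (u v : V) :
    V →ₗ[ℝ] V :=
  ((Γ'.flip u).flip v : V →ₗ[ℝ] V) - ((Γ' u).flip v : V →ₗ[ℝ] V)
    + (Γ.flip (Γ u v) : V →ₗ[ℝ] V) - (Γ u : V →ₗ[ℝ] V) ∘ₗ (Γ.flip v : V →ₗ[ℝ] V)

variable {Γ : V →L[ℝ] V →L[ℝ] V} {Γ' : V →L[ℝ] V →L[ℝ] V →L[ℝ] V} {J : V →L[ℝ] V}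
  {g : V →L[ℝ] V →L[ℝ] ℝ}

theorem curvatureEndo_apply (u v X : V) :
    curvatureEndo Γ Γ' u v X = curvature Γ Γ' X u v := by
  simp [curvatureEndo, curvature]

theorem curvature_swap (X Y Z : V) : curvature Γ Γ' X Y Z = - curvature Γ Γ' Y X Z := by
  simp only [curvature]; abel

theorem curvature_bianchi (hΓ : ∀ X Y, Γ X Y = Γ Y X) (hΓ' : ∀ W X Y, Γ' W X Y = Γ' W Y X)
    (X Y Z : V) :
    curvature Γ Γ' X Y Z + curvature Γ Γ' Y Z X + curvature Γ Γ' Z X Y = 0 := by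
  simp only [curvature]
  rw [hΓ' X Y Z, hΓ' Y X Z, hΓ' Z X Y, hΓ Y Z, hΓ X Z, hΓ X Y]
  abel

theorem curvature_comp_complex (hJ : ∀ X Y, Γ X (J Y) = J (Γ X Y))
    (hJ' : ∀ W X Y, Γ' W X (J Y) = J (Γ' W X Y)) (X Y Z : V) :
    curvature Γ Γ' X Y (J Z) = J (curvature Γ Γ' X Y Z) := by
  simp [curvature, hJ, hJ']

/-- The classical octahedron argument: the four cyclic Bianchi identities combine linearly with
skewness in each pair of arguments. -/
theorem curvature_pair_symm (hΓ : ∀ X Y, Γ X Y = Γ Y X) (hΓ' : ∀ W X Y, Γ' W X Y = Γ' W Y X)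
    (hsymm : ∀ X Y, g X Y = g Y X)
    (hskew : ∀ X Y Z W, g (curvature Γ Γ' X Y Z) W + g Z (curvature Γ Γ' X Y W) = 0)
    (X Y Z W : V) :
    g (curvature Γ Γ' X Y Z) W = g (curvature Γ Γ' Z W X) Y := by
  have hb : ∀ X Y Z W, g (curvature Γ Γ' X Y Z) W + g (curvature Γ Γ' Y Z X) W
      + g (curvature Γ Γ' Z X Y) W = 0 := fun X Y Z W => by
    have := congrArg (fun T => g T W) (curvature_bianchi hΓ hΓ' X Y Z)
    simpa using this
  have hs : ∀ X Y Z W, g (curvature Γ Γ' X Y Z) W = - g (curvature Γ Γ' X Y W) Z :=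
    fun X Y Z W => by
      have := hskew X Y Z W
      rw [hsymm Z] at this
      linarith
  have ha : ∀ X Y Z W, g (curvature Γ Γ' X Y Z) W = - g (curvature Γ Γ' Y X Z) W :=
    fun X Y Z W => by rw [curvature_swap X Y Z]; simp
  linarith [hb X Y Z W, hb Y Z W X, hb Z W X Y, hb W X Y Z, hs X Y Z W, hs Y Z X W, hs Z X Y W,
    hs Y Z W X, hs Z W Y X, hs W Y Z X, hs Z W X Y, hs W X Z Y, hs X Z W Y, hs W X Y Z,
    hs X Y W Z, hs Y W X Z, ha X Y Z W, ha X Z Y W, ha X Z W Y, ha Y W X Z, ha Y W Z X,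
    ha X Y W Z, ha Z W X Y, ha Z W Y X]

/-- Pair symmetry moves `J` from the first two arguments to the last two, where the curvature
commutes with `J` and `J` is an isometry. -/
theorem curvature_complex_complex (hΓ : ∀ X Y, Γ X Y = Γ Y X)
    (hΓ' : ∀ W X Y, Γ' W X Y = Γ' W Y X)
    (hJ : ∀ X Y, Γ X (J Y) = J (Γ X Y)) (hJ' : ∀ W X Y, Γ' W X (J Y) = J (Γ' W X Y))
    (hsymm : ∀ X Y, g X Y = g Y X) (hnd : ∀ X, (∀ Y, g X Y = 0) → X = 0)
    (hherm : ∀ X Y, g (J X) (J Y) = g X Y)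
    (hskew : ∀ X Y Z W, g (curvature Γ Γ' X Y Z) W + g Z (curvature Γ Γ' X Y W) = 0)
    (X Y Z : V) :
    curvature Γ Γ' (J X) (J Y) Z = curvature Γ Γ' X Y Z := by
  rw [← sub_eq_zero]
  refine hnd _ fun W => ?_
  rw [map_sub, sub_apply, curvature_pair_symm hΓ hΓ' hsymm hskew,
    curvature_comp_complex hJ hJ', hherm, ← curvature_pair_symm hΓ hΓ' hsymm hskew, sub_self]

/-- The Ricci tensor of a Kähler connection is minus the `J`-invariant part of the derivative of
the trace of the Christoffel tensor. -/
theorem trace_curvatureEndo [FiniteDimensional ℝ V] (hΓ : ∀ X Y, Γ X Y = Γ Y X)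
    (hΓ' : ∀ W X Y, Γ' W X Y = Γ' W Y X)
    (hJJ : ∀ X, J (J X) = -X)
    (hJ : ∀ X Y, Γ X (J Y) = J (Γ X Y)) (hJ' : ∀ W X Y, Γ' W X (J Y) = J (Γ' W X Y))
    (hsymm : ∀ X Y, g X Y = g Y X) (hnd : ∀ X, (∀ Y, g X Y = 0) → X = 0)
    (hherm : ∀ X Y, g (J X) (J Y) = g X Y)
    (hskew : ∀ X Y Z W, g (curvature Γ Γ' X Y Z) W + g Z (curvature Γ Γ' X Y W) = 0)
    (u v : V) :
    LinearMap.trace ℝ V (curvatureEndo Γ Γ' u v) =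
      -(1 / 2) * (LinearMap.trace ℝ V (Γ' u v : V →ₗ[ℝ] V)
        + LinearMap.trace ℝ V (Γ' (J u) (J v) : V →ₗ[ℝ] V)) := by
  have hR := curvature_complex_complex hΓ hΓ' hJ hJ' hsymm hnd hherm hskew
  have hinv : LinearMap.trace ℝ V (curvatureEndo Γ Γ' (J u) (J v))
      = LinearMap.trace ℝ V (curvatureEndo Γ Γ' u v) := by
    -- Conjugating by `J` costs a sign: the endomorphism for `(Ju, Jv)` is `-J E J`, with the same
    -- trace as `E` since `J² = -1`.
    have h1 : curvatureEndo Γ Γ' (J u) (J v)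
        = -((J : V →ₗ[ℝ] V) ∘ₗ (curvatureEndo Γ Γ' u v ∘ₗ (J : V →ₗ[ℝ] V))) := by
      ext X
      have h2 : curvature Γ Γ' X (J u) v = -curvature Γ Γ' (J X) u v := by
        have := hR (J X) u v
        rw [hJJ] at this
        rw [← this]
        simp [curvature]; abel
      simp only [curvatureEndo_apply, LinearMap.neg_apply, LinearMap.comp_apply,
        ContinuousLinearMap.coe_coe, curvature_comp_complex hJ hJ', h2, map_neg]
    have h3 : (curvatureEndo Γ Γ' u v ∘ₗ (J : V →ₗ[ℝ] V)) ∘ₗ (J : V →ₗ[ℝ] V)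
        = -curvatureEndo Γ Γ' u v := by
      ext X
      simp [hJJ]
    rw [h1, map_neg, LinearMap.trace_comp_comm', h3, map_neg, neg_neg]
  -- Every term that is complex linear in `u` and `v` cancels against its `(Ju, Jv)` counterpart,
  -- quadratic terms included. Only the terms with `u` or `Ju` as direction of differentiation
  -- survive.
  have hsum : curvatureEndo Γ Γ' u v + curvatureEndo Γ Γ' (J u) (J v)
      = -((Γ' u v : V →ₗ[ℝ] V) + (Γ' (J u) (J v) : V →ₗ[ℝ] V)) := by
    ext X
    have hJl : ∀ X Y, Γ (J X) Y = J (Γ X Y) := fun X Y => by rw [hΓ, hJ, hΓ]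
    have hJl' : ∀ W X Y, Γ' W (J X) Y = J (Γ' W X Y) := fun W X Y => by rw [hΓ', hJ', hΓ']
    simp only [LinearMap.add_apply, LinearMap.neg_apply, curvatureEndo_apply, curvature,
      ContinuousLinearMap.coe_coe, hJ, hJ', hJl, hJl', hJJ, map_neg]
    rw [hΓ' u X v, hΓ' (J u) X v]
    abel
  have := congrArg (LinearMap.trace ℝ V) hsum
  rw [map_add, map_neg, map_add, hinv] at this
  linarith

end ComplexBilinearConnection

/-! ### Coordinates on `ℂ × ℂ` and the derivative of a determinant. -/

theorem isOpen_pairSpace : IsOpen pairSpace := by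
  have h1 : IsOpen {p : CC | 0 < p.1.im} :=
    isOpen_lt continuous_const (Complex.continuous_im.comp continuous_fst)
  have h2 : IsOpen {p : CC | 0 < p.2.im} :=
    isOpen_lt continuous_const (Complex.continuous_im.comp continuous_snd)
  have h3 : IsOpen {p : CC | p.1 ≠ p.2} := isOpen_ne_fun continuous_fst continuous_snd
  exact h1.inter (h2.inter h3)

/-- The coordinate basis of `ℂ × ℂ`. -/
def coordBasis : Module.Basis (Fin 4) ℝ CC := Module.Basis.ofEquivFun
  { toFun := coords
    invFun := fun w => (⟨w 0, w 1⟩, ⟨w 2, w 3⟩)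
    map_add' := fun u v => by ext i; fin_cases i <;> simp [coords]
    map_smul' := fun c v => by ext i; fin_cases i <;> simp [coords]
    left_inv := fun v => by simp [coords]
    right_inv := fun w => by ext i; fin_cases i <;> simp [coords] }

theorem coordBasis_repr (v : CC) (i : Fin 4) : coordBasis.repr v i = coords v i := rfl

theorem coordBasis_apply (i : Fin 4) : coordBasis i = coordVec i := by
  rw [← coordBasis.repr.injective.eq_iff]
  ext j
  rw [coordBasis.repr_self, coordBasis_repr]
  fin_cases i <;> fin_cases j <;> simp [coords, coordVec]

theorem sum_coords_smul (v : CC) : ∑ i, coords v i • coordVec i = v := by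
  have := coordBasis.sum_repr v
  simpa only [coordBasis_repr, coordBasis_apply] using this

theorem coords_coordVec (i j : Fin 4) : coords (coordVec i) j = if i = j then 1 else 0 := by
  rw [← coordBasis_repr, ← coordBasis_apply, coordBasis.repr_self, Finsupp.single_apply]

/-- The coordinate functionals. -/
def coordL (i : Fin 4) : CC →L[ℝ] ℝ := LinearMap.toContinuousLinearMap (coordBasis.coord i)

theorem coordL_apply (i : Fin 4) (v : CC) : coordL i v = coords v i := rfl

theorem trace_eq_sum_coords (F : CC →ₗ[ℝ] CC) :
    LinearMap.trace ℝ CC F = ∑ i, coords (F (coordVec i)) i := by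
  rw [LinearMap.trace_eq_matrix_trace ℝ coordBasis, Matrix.trace]
  simp [LinearMap.toMatrix_apply, coordBasis_apply, coordBasis_repr]

theorem clm_ext_coordVec {E : Type*} [NormedAddCommGroup E] [NormedSpace ℝ E]
    {F H : CC →L[ℝ] E} (h : ∀ i, F (coordVec i) = H (coordVec i)) : F = H := by
  refine ContinuousLinearMap.ext fun v => ?_
  rw [← sum_coords_smul v]
  simp [map_sum, h]

/-- Multiplication by `i` on `ℂ × ℂ`. -/
def complexJ : CC →L[ℝ] CC := Complex.I • ContinuousLinearMap.id ℝ CC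

theorem complexJ_apply (v : CC) : complexJ v = Complex.I • v := rfl

/-- Jacobi's formula. -/
theorem hasFDerivAt_det {E n : Type*} [NormedAddCommGroup E] [NormedSpace ℝ E] [Fintype n]
    [DecidableEq n] {M : E → Matrix n n ℝ} {M' : n → n → E →L[ℝ] ℝ} {p : E}
    (h : ∀ i j, HasFDerivAt (fun q => M q i j) (M' i j) p) :
    HasFDerivAt (fun q => (M q).det) (∑ i, ∑ j, (M p).adjugate i j • M' j i) p := by
  have h1 : HasFDerivAt (fun q => (M q).det) (∑ σ : Equiv.Perm n, (Equiv.Perm.sign σ : ℝ) •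
      ∑ k, (∏ i ∈ Finset.univ.erase k, M p (σ i) i) • M' (σ k) k) p := by
    simp only [Matrix.det_apply']
    refine HasFDerivAt.fun_sum fun σ _ => ?_
    refine HasFDerivAt.const_mul ?_ _
    have := HasFDerivAt.finsetProd (u := Finset.univ) fun i _ => h (σ i) i
    simpa only [Finset.prod_fn] using this
  convert! h1 using 1
  ext v
  simp only [sum_apply, smul_apply, smul_eq_mul]
  -- Cramer's rule: a row of the adjugate paired with a vector is the determinant with that column
  -- replaced.
  have h2 : ∀ i, ∑ j, (M p).adjugate i j * M' j i v
      = ((M p).updateCol i (fun j => M' j i v)).det := fun i => by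
    rw [← Matrix.cramer_apply, Matrix.cramer_eq_adjugate_mulVec]
    rfl
  simp only [h2, Matrix.det_apply', Finset.mul_sum]
  rw [Finset.sum_comm]
  refine Finset.sum_congr rfl fun σ _ => Finset.sum_congr rfl fun k _ => ?_
  congr 1
  rw [← Finset.mul_prod_erase _ _ (Finset.mem_univ k), mul_comm]
  congr 1
  · refine Finset.prod_congr rfl fun i hi => ?_
    rw [Matrix.updateCol_ne (Finset.ne_of_mem_erase hi)]
  · simp

/-! ### The Levi-Civita connection and its Ricci tensor, free of indices. -/

section Metric

variable {γ : CC → Bilin} {p : CC}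

theorem fderiv_bilin_apply {γ : CC → Bilin} {p : CC} (h : DifferentiableAt ℝ γ p) (u v w : CC) :
    fderiv ℝ (fun q => γ q v w) p u = fderiv ℝ γ p u v w := by
  have h1 := ((h.hasFDerivAt.clm_apply (hasFDerivAt_const v p)).clm_apply (hasFDerivAt_const w p))
  rw [h1.fderiv]
  simp

theorem pderiv_gram (h : DifferentiableAt ℝ γ p) (i j l : Fin 4) :
    pderiv i (fun q => gram γ q j l) p = fderiv ℝ γ p (coordVec i) (coordVec j) (coordVec l) :=
  fderiv_bilin_apply h _ _ _

theorem pairSpace_mem_nhds (hp : p ∈ pairSpace) : pairSpace ∈ nhds p := isOpen_pairSpace.mem_nhds hp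

namespace IsRiemannianMetric

variable (hγ : IsRiemannianMetric γ) (hp : p ∈ pairSpace)

include hγ hp

theorem contDiffAt : ContDiffAt ℝ ∞ γ p := hγ.smooth.contDiffAt (pairSpace_mem_nhds hp)

theorem differentiableAt : DifferentiableAt ℝ γ p := (hγ.contDiffAt hp).differentiableAt (by simp)

theorem differentiableAt_fderiv : DifferentiableAt ℝ (fderiv ℝ γ) p :=
  ((hγ.contDiffAt hp).fderiv_right (m := ∞) (by simp)).differentiableAt (by simp)

theorem eq_zero_of_forall {X : CC} (h : ∀ Y, γ p X Y = 0) : X = 0 := by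
  by_contra hX
  exact (hγ.pos p hp X hX).ne' (h X)

theorem posDef_gram : (gram γ p).PosDef := by
  have hform : ∀ x : Fin 4 → ℝ, star x ⬝ᵥ (gram γ p).mulVec x
      = γ p (∑ i, x i • coordVec i) (∑ i, x i • coordVec i) := fun x => by
    simp only [map_sum, map_smul, sum_apply, smul_apply, smul_eq_mul, dotProduct,
      Matrix.mulVec, gram, Matrix.of_apply, Finset.mul_sum, Pi.star_apply, star_trivial]
    rw [Finset.sum_comm]
    refine Finset.sum_congr rfl fun i _ => Finset.sum_congr rfl fun j _ => ?_
    ring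
  refine Matrix.PosDef.of_dotProduct_mulVec_pos ?_ fun x hx => ?_
  · ext i j
    simp [gram, hγ.symm p hp]
  · rw [hform]
    refine hγ.pos p hp _ fun h0 => hx ?_
    have h1 : ∑ i, x i • coordBasis i = 0 := by simpa only [coordBasis_apply] using h0
    funext i
    exact Fintype.linearIndependent_iff.1 coordBasis.linearIndependent x h1 i

theorem det_gram_pos : 0 < (gram γ p).det := (hγ.posDef_gram hp).det_pos

theorem fderiv_symm (X Y Z : CC) : fderiv ℝ γ p X Y Z = fderiv ℝ γ p X Z Y := by
  rw [← fderiv_bilin_apply (hγ.differentiableAt hp), ← fderiv_bilin_apply (hγ.differentiableAt hp)]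
  congr 1
  refine Filter.EventuallyEq.fderiv_eq ?_
  filter_upwards [pairSpace_mem_nhds hp] with q hq using hγ.symm q hq Y Z

end IsRiemannianMetric

/-- The Christoffel symbols as a `CC`-valued bilinear map. -/
def christoffelMap (γ : CC → Bilin) (p : CC) : CC →L[ℝ] CC →L[ℝ] CC :=
  ∑ k, ∑ i, ∑ j, christoffel γ k i j p •
    (coordL i).smulRight ((coordL j).smulRight (coordVec k))

theorem christoffelMap_coordVec (i j : Fin 4) :
    christoffelMap γ p (coordVec i) (coordVec j) = ∑ k, christoffel γ k i j p • coordVec k := by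
  simp [christoffelMap, sum_apply, coordL_apply, coords_coordVec]

theorem coords_christoffelMap (k i j : Fin 4) :
    coords (christoffelMap γ p (coordVec i) (coordVec j)) k = christoffel γ k i j p := by
  rw [christoffelMap_coordVec, ← coordL_apply]
  simp [coordL_apply, coords_coordVec]

namespace IsRiemannianMetric

variable (hγ : IsRiemannianMetric γ) (hp : p ∈ pairSpace)

include hγ hp

/-- The Koszul formula. -/
theorem apply_christoffelMap (X Y Z : CC) :
    γ p (christoffelMap γ p X Y) Z
      = 1 / 2 * (fderiv ℝ γ p X Y Z + fderiv ℝ γ p Y X Z - fderiv ℝ γ p Z X Y) := by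
  set D := fderiv ℝ γ p with hD
  -- Both sides are trilinear, so coordinate vectors suffice. The last summand of `K` is `D.flip`
  -- with its last two slots exchanged, which realises `D Z X Y`.
  let K : CC →L[ℝ] CC →L[ℝ] CC →L[ℝ] ℝ := (1 / 2 : ℝ) • (D + D.flip -
    ((ContinuousLinearMap.flipₗᵢ ℝ CC CC ℝ).toContinuousLinearEquiv.toContinuousLinearMap ∘L D.flip))
  let L : CC →L[ℝ] CC →L[ℝ] CC →L[ℝ] ℝ :=
    (ContinuousLinearMap.compL ℝ CC CC (CC →L[ℝ] ℝ) (γ p)) ∘L christoffelMap γ p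
  have hKL : L = K := by
    refine clm_ext_coordVec fun i => clm_ext_coordVec fun j => clm_ext_coordVec fun l => ?_
    have h1 : L (coordVec i) (coordVec j) (coordVec l)
        = γ p (christoffelMap γ p (coordVec i) (coordVec j)) (coordVec l) := rfl
    have h2 : K (coordVec i) (coordVec j) (coordVec l)
        = 1 / 2 * (D (coordVec i) (coordVec j) (coordVec l)
          + D (coordVec j) (coordVec i) (coordVec l)
          - D (coordVec l) (coordVec i) (coordVec j)) := rfl
    rw [h1, h2, christoffelMap_coordVec]
    set S : Fin 4 → ℝ := fun l => D (coordVec i) (coordVec j) (coordVec l)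
      + D (coordVec j) (coordVec i) (coordVec l) - D (coordVec l) (coordVec i) (coordVec j) with hS
    have h3 : ∀ k, christoffel γ k i j p = 1 / 2 * ((gram γ p)⁻¹.mulVec S) k := fun k => by
      simp only [christoffel, pderiv_gram (hγ.differentiableAt hp)]
      rfl
    have h4 : (gram γ p).mulVec ((gram γ p)⁻¹.mulVec S) = S := by
      rw [Matrix.mulVec_mulVec, Matrix.mul_nonsing_inv _ (hγ.det_gram_pos hp).ne'.isUnit,
        Matrix.one_mulVec]
    have h5 := congrFun h4 l
    simp only [map_sum, map_smul, sum_apply, smul_apply, smul_eq_mul, h3]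
    change _ = 1 / 2 * S l
    rw [← h5]
    conv_rhs => rw [Matrix.mulVec, dotProduct, Finset.mul_sum]
    refine Finset.sum_congr rfl fun k _ => ?_
    simp only [gram, Matrix.of_apply]
    rw [hγ.symm p hp (coordVec l)]
    ring
  have := congrArg (fun F : CC →L[ℝ] CC →L[ℝ] CC →L[ℝ] ℝ => F X Y Z) hKL
  exact this

theorem christoffelMap_symm (X Y : CC) : christoffelMap γ p X Y = christoffelMap γ p Y X := by
  rw [← sub_eq_zero]
  refine hγ.eq_zero_of_forall hp fun Z => ?_
  rw [map_sub, sub_apply, hγ.apply_christoffelMap hp, hγ.apply_christoffelMap hp,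
    hγ.fderiv_symm hp Z X Y]
  ring

/-- The Levi-Civita connection is compatible with the metric. -/
theorem fderiv_eq (X Y Z : CC) :
    fderiv ℝ γ p X Y Z
      = γ p (christoffelMap γ p X Y) Z + γ p Y (christoffelMap γ p X Z) := by
  rw [hγ.symm p hp Y, hγ.apply_christoffelMap hp, hγ.apply_christoffelMap hp,
    hγ.fderiv_symm hp X Z Y, hγ.fderiv_symm hp Y X Z, hγ.fderiv_symm hp Z X Y]
  ring

theorem differentiableAt_pderiv_gram (i j l : Fin 4) :
    DifferentiableAt ℝ (pderiv i (fun q => gram γ q j l)) p := by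
  have h : DifferentiableAt ℝ
      (fun q => fderiv ℝ γ q (coordVec i) (coordVec j) (coordVec l)) p :=
    ((((hγ.differentiableAt_fderiv hp).clm_apply (differentiableAt_const _)).clm_apply
      (differentiableAt_const _)).clm_apply (differentiableAt_const _))
  refine h.congr_of_eventuallyEq ?_
  filter_upwards [pairSpace_mem_nhds hp] with q hq using pderiv_gram (hγ.differentiableAt hq) i j l

theorem hasFDerivAt_gram (i j : Fin 4) :
    HasFDerivAt (fun q => gram γ q i j)
      (((fderiv ℝ γ p).flip (coordVec i)).flip (coordVec j)) p := by
  have h1 := (((hγ.differentiableAt hp).hasFDerivAt.clm_apply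
    (hasFDerivAt_const (coordVec i) p)).clm_apply (hasFDerivAt_const (coordVec j) p))
  refine h1.congr_fderiv ?_
  ext v <;> simp

theorem differentiableAt_inv_gram (i j : Fin 4) :
    DifferentiableAt ℝ (fun q => (gram γ q)⁻¹ i j) p := by
  have hg : ∀ i j, DifferentiableAt ℝ (fun q => gram γ q i j) p := fun i j =>
    (hγ.hasFDerivAt_gram hp i j).differentiableAt
  have hdet : DifferentiableAt ℝ (fun q => (gram γ q).det) p :=
    (hasFDerivAt_det (hγ.hasFDerivAt_gram hp)).differentiableAt
  -- Each adjugate entry is itself a determinant, with one row made constant.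
  have hadj : DifferentiableAt ℝ (fun q => (gram γ q).adjugate i j) p := by
    simp only [Matrix.adjugate_apply]
    refine (hasFDerivAt_det (M := fun q => (gram γ q).updateRow j (Pi.single i 1))
      (M' := fun k l => fderiv ℝ (fun q => (gram γ q).updateRow j (Pi.single i 1) k l) p)
      fun k l => ?_).differentiableAt
    refine DifferentiableAt.hasFDerivAt ?_
    by_cases h : k = j
    · subst h; simp
    · simpa [Matrix.updateRow_ne h] using hg k l
  simp only [Matrix.inv_def, Ring.inverse_eq_inv', Matrix.smul_apply, smul_eq_mul]
  exact (hdet.inv (hγ.det_gram_pos hp).ne').mul hadj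

theorem differentiableAt_christoffel (k i j : Fin 4) :
    DifferentiableAt ℝ (christoffel γ k i j) p := by
  refine DifferentiableAt.const_mul (DifferentiableAt.fun_sum fun l _ => ?_) _
  exact (hγ.differentiableAt_inv_gram hp k l).mul
    (((hγ.differentiableAt_pderiv_gram hp i j l).add
      (hγ.differentiableAt_pderiv_gram hp j i l)).sub (hγ.differentiableAt_pderiv_gram hp l i j))

theorem differentiableAt_christoffelMap : DifferentiableAt ℝ (christoffelMap γ) p := by
  unfold christoffelMap
  exact DifferentiableAt.fun_sum fun k _ => DifferentiableAt.fun_sum fun i _ =>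
    DifferentiableAt.fun_sum fun j _ =>
      (hγ.differentiableAt_christoffel hp k i j).smul_const _

theorem hasFDerivAt_christoffelMap_apply (X Y : CC) :
    HasFDerivAt (fun q => christoffelMap γ q X Y)
      (((fderiv ℝ (christoffelMap γ) p).flip X).flip Y) p := by
  have h1 := (((hγ.differentiableAt_christoffelMap hp).hasFDerivAt.clm_apply
    (hasFDerivAt_const X p)).clm_apply (hasFDerivAt_const Y p))
  refine h1.congr_fderiv ?_
  ext v <;> simp

theorem pderiv_christoffel (i l j k : Fin 4) :
    pderiv i (christoffel γ l j k) p
      = coords (fderiv ℝ (christoffelMap γ) p (coordVec i) (coordVec j) (coordVec k)) l := by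
  have h1 := ((coordL l).hasFDerivAt.comp p
    (hγ.hasFDerivAt_christoffelMap_apply hp (coordVec j) (coordVec k)))
  have h2 : christoffel γ l j k
      = coordL l ∘ fun q => christoffelMap γ q (coordVec j) (coordVec k) := by
    funext q
    simp [coordL_apply, coords_christoffelMap]
  rw [pderiv, h2, h1.fderiv]
  rfl

/-- The components of the Riemann tensor. -/
theorem riemann_eq (l k i j : Fin 4) :
    riemann γ l k i j p = coords (curvature (christoffelMap γ p)
      (fderiv ℝ (christoffelMap γ) p) (coordVec i) (coordVec j) (coordVec k)) l := by
  rw [riemann, hγ.pderiv_christoffel hp, hγ.pderiv_christoffel hp, curvature]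
  have h : ∀ i j, coordL l (christoffelMap γ p (coordVec i)
      (christoffelMap γ p (coordVec j) (coordVec k)))
      = ∑ m, christoffel γ l i m p * christoffel γ m j k p := fun i j => by
    rw [christoffelMap_coordVec j k]
    simp only [map_sum, map_smul, smul_eq_mul]
    refine Finset.sum_congr rfl fun m _ => ?_
    rw [coordL_apply, coords_christoffelMap, mul_comm]
  simp only [← coordL_apply, map_sub, map_add, h, Finset.sum_sub_distrib]
  ring

/-- The Ricci tensor as a trace. -/
theorem ricci_eq_trace (u v : CC) :
    ricci γ p u v = LinearMap.trace ℝ CC (curvatureEndo (christoffelMap γ p)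
      (fderiv ℝ (christoffelMap γ) p) u v) := by
  -- Packaging the trace as a bilinear form in `u, v` reduces the claim to coordinate vectors.
  let B : CC →ₗ[ℝ] CC →ₗ[ℝ] ℝ := LinearMap.mk₂ ℝ (fun u v => LinearMap.trace ℝ CC
      (curvatureEndo (christoffelMap γ p) (fderiv ℝ (christoffelMap γ) p) u v))
    (fun u u' v => by
      rw [← map_add]; congr 1; ext X <;> simp [curvatureEndo] <;> ring)
    (fun c u v => by
      rw [← map_smul]; congr 1; ext X <;> simp [curvatureEndo] <;> ring)
    (fun u v v' => by
      rw [← map_add]; congr 1; ext X <;> simp [curvatureEndo] <;> ring)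
    (fun c u v => by
      rw [← map_smul]; congr 1; ext X <;> simp [curvatureEndo] <;> ring)
  have h1 : B u v = ∑ j, ∑ k, B (coordVec j) (coordVec k) * coords u j * coords v k := by
    conv_lhs => rw [← sum_coords_smul u, ← sum_coords_smul v]
    simp only [map_sum, map_smul, LinearMap.sum_apply, LinearMap.smul_apply, smul_eq_mul,
      Finset.mul_sum]
    rw [Finset.sum_comm]
    refine Finset.sum_congr rfl fun j _ => Finset.sum_congr rfl fun k _ => ?_
    ring
  change _ = B u v
  rw [h1, ricci]
  refine Finset.sum_congr rfl fun j _ => Finset.sum_congr rfl fun k _ => ?_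
  congr 2
  change _ = LinearMap.trace ℝ CC (curvatureEndo _ _ (coordVec j) (coordVec k))
  rw [trace_eq_sum_coords]
  exact Finset.sum_congr rfl fun i _ => by rw [hγ.riemann_eq hp, curvatureEndo_apply]

end IsRiemannianMetric

end Metric

/-! ### Kähler identities and the Ricci tensor as a complex Hessian. -/

section Kahler

variable {γ : CC → Bilin} {p : CC}

theorem complexJ_complexJ (v : CC) : complexJ (complexJ v) = -v := by
  rw [complexJ_apply, complexJ_apply, smul_smul, Complex.I_mul_I, neg_one_smul]

namespace IsRiemannianMetric

variable (hγ : IsRiemannianMetric γ) (hp : p ∈ pairSpace)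

include hγ hp

/-- Skew-symmetry of the curvature of the Levi-Civita connection. -/
theorem curvature_skew (X Y Z W : CC) :
    γ p (curvature (christoffelMap γ p) (fderiv ℝ (christoffelMap γ) p) X Y Z) W
      + γ p Z (curvature (christoffelMap γ p) (fderiv ℝ (christoffelMap γ) p) X Y W) = 0 := by
  set Γ := christoffelMap γ p
  set Γ' := fderiv ℝ (christoffelMap γ) p
  -- Differentiate metric compatibility once more; antisymmetrising in `X, Y` kills the second
  -- derivative of `γ` and leaves the curvature.
  have h2 : ∀ X Y, fderiv ℝ (fderiv ℝ γ) p X Y Z W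
      = fderiv ℝ γ p X (Γ Y Z) W + γ p (Γ' X Y Z) W
        + (fderiv ℝ γ p X Z (Γ Y W) + γ p Z (Γ' X Y W)) := fun X Y => by
    have hd := (hγ.differentiableAt hp).hasFDerivAt
    have e1 := (((hγ.differentiableAt_fderiv hp).hasFDerivAt.clm_apply
      (hasFDerivAt_const Y p)).clm_apply (hasFDerivAt_const Z p)).clm_apply
      (hasFDerivAt_const W p)
    have e2 := (hd.clm_apply (hγ.hasFDerivAt_christoffelMap_apply hp Y Z)).clm_apply
      (hasFDerivAt_const W p)
    have e3 := (hd.clm_apply (hasFDerivAt_const Z p)).clm_apply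
      (hγ.hasFDerivAt_christoffelMap_apply hp Y W)
    have e4 := (e2.add e3).congr_of_eventuallyEq (f₁ := fun q => fderiv ℝ γ q Y Z W) (by
      filter_upwards [pairSpace_mem_nhds hp] with q hq using hγ.fderiv_eq hq Y Z W)
    have e5 := congrArg (fun F : CC →L[ℝ] ℝ => F X) (e1.unique e4)
    simp at e5
    rw [e5]
    ring
  have hs : fderiv ℝ (fderiv ℝ γ) p X Y = fderiv ℝ (fderiv ℝ γ) p Y X :=
    (hγ.contDiffAt hp).isSymmSndFDerivAt (by
      rw [minSmoothness_of_isRCLikeNormedField]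
      exact WithTop.coe_le_coe.2 (le_top : (2 : ℕ∞) ≤ ⊤)) X Y
  have h3 := h2 X Y
  rw [hs, h2 Y X] at h3
  simp only [hγ.fderiv_eq hp] at h3
  simp only [curvature, map_add, map_sub, add_apply, sub_apply]
  linarith

theorem christoffelMap_deriv_symm (W X Y : CC) :
    fderiv ℝ (christoffelMap γ) p W X Y = fderiv ℝ (christoffelMap γ) p W Y X := by
  have e1 := (hγ.hasFDerivAt_christoffelMap_apply hp Y X).congr_of_eventuallyEq
    (f₁ := fun q => christoffelMap γ q X Y) (by
      filter_upwards [pairSpace_mem_nhds hp] with q hq using hγ.christoffelMap_symm hq X Y)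
  exact congrArg (fun F : CC →L[ℝ] CC => F W)
    ((hγ.hasFDerivAt_christoffelMap_apply hp X Y).unique e1)

/-- `∂ᵥ log det γ = 2 tr Γᵥ`. -/
theorem fderiv_log_det_gram (v : CC) :
    fderiv ℝ (fun q => Real.log (gram γ q).det) p v
      = 2 * LinearMap.trace ℝ CC (christoffelMap γ p v : CC →ₗ[ℝ] CC) := by
  have hpos := hγ.det_gram_pos hp
  rw [((hasFDerivAt_det (hγ.hasFDerivAt_gram hp)).log hpos.ne').fderiv]
  simp only [smul_apply, sum_apply, smul_eq_mul, ContinuousLinearMap.flip_apply]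
  have hM : Matrix.of (fun i j => γ p (coordVec i) (christoffelMap γ p v (coordVec j)))
      = gram γ p * LinearMap.toMatrix coordBasis coordBasis
        (christoffelMap γ p v : CC →ₗ[ℝ] CC) := by
    ext i j
    simp only [Matrix.of_apply, Matrix.mul_apply, gram, LinearMap.toMatrix_apply,
      coordBasis_apply, coordBasis_repr, ContinuousLinearMap.coe_coe]
    conv_lhs => rw [← sum_coords_smul (christoffelMap γ p v (coordVec j))]
    simp [mul_comm]
  -- In Jacobi's formula, `adj(G) G = det(G) 1` turns the sum into `det(G)` times the trace of `Γᵥ`.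
  have h1 : ∑ i, ∑ j, (gram γ p).adjugate i j * γ p (coordVec j)
      (christoffelMap γ p v (coordVec i))
      = (gram γ p).det * LinearMap.trace ℝ CC (christoffelMap γ p v : CC →ₗ[ℝ] CC) := by
    rw [LinearMap.trace_eq_matrix_trace ℝ coordBasis, ← smul_eq_mul, ← Matrix.trace_smul,
      ← Matrix.one_mul (LinearMap.toMatrix _ _ _), ← Matrix.smul_mul, ← Matrix.adjugate_mul,
      Matrix.mul_assoc, ← hM]
    simp [Matrix.trace, Matrix.mul_apply]
  have hadj : ∀ i j, (gram γ p).adjugate i j = (gram γ p).adjugate j i := fun i j => by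
    have h : (gram γ p).transpose = gram γ p := by
      ext i j
      exact hγ.symm p hp _ _
    conv_lhs => rw [← h, ← Matrix.adjugate_transpose, Matrix.transpose_apply]
  have h2 : ∑ i, ∑ j, (gram γ p).adjugate i j * γ p (christoffelMap γ p v (coordVec j))
      (coordVec i)
      = (gram γ p).det * LinearMap.trace ℝ CC (christoffelMap γ p v : CC →ₗ[ℝ] CC) := by
    rw [← h1, Finset.sum_comm]
    refine Finset.sum_congr rfl fun i _ => Finset.sum_congr rfl fun j _ => ?_
    rw [hadj, hγ.symm p hp]
  simp only [hγ.fderiv_eq hp, mul_add, Finset.sum_add_distrib, h1, h2]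
  field_simp
  ring

end IsRiemannianMetric

namespace IsKahlerMetric

variable (hγ : IsKahlerMetric γ) (hp : p ∈ pairSpace)

include hγ hp

theorem fderiv_hermitian (X Y Z : CC) :
    fderiv ℝ γ p X (complexJ Y) (complexJ Z) = fderiv ℝ γ p X Y Z := by
  have hd := hγ.toIsRiemannianMetric.differentiableAt hp
  rw [← fderiv_bilin_apply hd, ← fderiv_bilin_apply hd]
  congr 1
  refine Filter.EventuallyEq.fderiv_eq ?_
  filter_upwards [pairSpace_mem_nhds hp] with q hq using hγ.hermitian q hq Y Z

theorem fderiv_closed (X Y Z : CC) :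
    fderiv ℝ γ p X (complexJ Y) Z + fderiv ℝ γ p Y (complexJ Z) X
      + fderiv ℝ γ p Z (complexJ X) Y = 0 := by
  have hd := hγ.toIsRiemannianMetric.differentiableAt hp
  have := hγ.closed p hp X Y Z
  simp only [kahlerForm] at this
  rw [fderiv_bilin_apply hd, fderiv_bilin_apply hd, fderiv_bilin_apply hd] at this
  exact this

/-- The complex structure of a Kähler metric is parallel. -/
theorem christoffelMap_complexJ (X Y : CC) :
    christoffelMap γ p X (complexJ Y) = complexJ (christoffelMap γ p X Y) := by
  have hR := hγ.toIsRiemannianMetric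
  rw [← sub_eq_zero]
  refine hR.eq_zero_of_forall hp fun Z => ?_
  have h1 : γ p (complexJ (christoffelMap γ p X Y)) Z
      = -γ p (christoffelMap γ p X Y) (complexJ Z) := by
    have := hγ.hermitian p hp (christoffelMap γ p X Y) (complexJ Z)
    rw [← complexJ_apply, ← complexJ_apply, complexJ_complexJ, map_neg] at this
    linarith
  rw [map_sub, sub_apply, h1, hR.apply_christoffelMap hp, hR.apply_christoffelMap hp]
  -- Closedness on `(JY, JZ, X)` and on `(Y, Z, X)`, together with the differentiated hermitian
  -- identity, gives `∇J = 0`. As `J` is constant in these coordinates, no torsion of `J` appears.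
  have e1 := hγ.fderiv_closed hp (complexJ Y) (complexJ Z) X
  have e2 := hγ.fderiv_closed hp Y Z X
  have e3 := hγ.fderiv_hermitian hp X (complexJ Y) Z
  have e4 := hγ.fderiv_hermitian hp X Y Z
  have e5 := hγ.fderiv_hermitian hp (complexJ Z) X Y
  have e6 := hγ.fderiv_hermitian hp Z (complexJ X) Y
  simp only [complexJ_complexJ, map_neg, neg_apply] at e1 e2 e3 e4 e5 e6
  rw [hR.fderiv_symm hp _ (complexJ Z) X] at e2
  rw [hR.fderiv_symm hp (complexJ Y) Z X] at e1
  linarith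

theorem christoffelMap_deriv_complexJ (W X Y : CC) :
    fderiv ℝ (christoffelMap γ) p W X (complexJ Y)
      = complexJ (fderiv ℝ (christoffelMap γ) p W X Y) := by
  have hR := hγ.toIsRiemannianMetric
  have e1 := (complexJ.hasFDerivAt.comp p
    (hR.hasFDerivAt_christoffelMap_apply hp X Y)).congr_of_eventuallyEq
    (f₁ := fun q => christoffelMap γ q X (complexJ Y)) (by
      filter_upwards [pairSpace_mem_nhds hp] with q hq using hγ.christoffelMap_complexJ hq X Y)
  exact congrArg (fun F : CC →L[ℝ] CC => F W)
    ((hR.hasFDerivAt_christoffelMap_apply hp X (complexJ Y)).unique e1)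

theorem fderiv_fderiv_log_det_gram (u v : CC) :
    fderiv ℝ (fun q => fderiv ℝ (fun q => Real.log (gram γ q).det) q v) p u
      = 2 * LinearMap.trace ℝ CC (fderiv ℝ (christoffelMap γ) p u v : CC →ₗ[ℝ] CC) := by
  have hR := hγ.toIsRiemannianMetric
  let τ : (CC →L[ℝ] CC) →L[ℝ] ℝ := LinearMap.toContinuousLinearMap
    ((LinearMap.trace ℝ CC) ∘ₗ (ContinuousLinearMap.coeLM ℝ))
  have e1 := τ.hasFDerivAt.comp p ((hR.differentiableAt_christoffelMap hp).hasFDerivAt.clm_apply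
    (hasFDerivAt_const v p))
  have e2 := (e1.const_mul 2).congr_of_eventuallyEq
    (f₁ := fun q => fderiv ℝ (fun q => Real.log (gram γ q).det) q v) (by
      filter_upwards [pairSpace_mem_nhds hp] with q hq using hR.fderiv_log_det_gram hq v)
  rw [e2.fderiv]
  simp [τ]

/-- The Ricci tensor of a Kähler metric in terms of the logarithm of the volume density. -/
theorem ricci_eq (u v : CC) :
    ricci γ p u v = -(1 / 4) *
      (fderiv ℝ (fun q => fderiv ℝ (fun q => Real.log (gram γ q).det) q v) p u
        + fderiv ℝ (fun q => fderiv ℝ (fun q => Real.log (gram γ q).det) q (Complex.I • v)) p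
          (Complex.I • u)) := by
  have hR := hγ.toIsRiemannianMetric
  -- The factor `1/4` is the `1/2` of `trace_curvatureEndo` times the `1/2` in `tr Γᵥ = ½ ∂ᵥ log det
  -- γ`.
  rw [hR.ricci_eq_trace hp, trace_curvatureEndo (J := complexJ) (g := γ p)
    (hR.christoffelMap_symm hp) (hR.christoffelMap_deriv_symm hp) complexJ_complexJ
    (hγ.christoffelMap_complexJ hp) (hγ.christoffelMap_deriv_complexJ hp) (hR.symm p hp)
    (fun X => hR.eq_zero_of_forall hp) (hγ.hermitian p hp) (hR.curvature_skew hp),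
    hγ.fderiv_fderiv_log_det_gram hp, hγ.fderiv_fderiv_log_det_gram hp, complexJ_apply,
    complexJ_apply]
  ring

end IsKahlerMetric

end Kahler

/-! ### The action on pairs of points, the frame, and the orbits. -/

section Moebius

open Matrix Complex

/-- The denominator of a fractional linear map. -/
def moebiusDenom (N : Matrix (Fin 2) (Fin 2) ℝ) (z : ℂ) : ℂ := (N 1 0 : ℂ) * z + (N 1 1 : ℂ)

variable (M : SpecialLinearGroup (Fin 2) ℝ) {z w : ℂ}

theorem specialLinear_det_eq :
    (M : Matrix (Fin 2) (Fin 2) ℝ) 0 0 * (M : Matrix (Fin 2) (Fin 2) ℝ) 1 1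
      - (M : Matrix (Fin 2) (Fin 2) ℝ) 0 1 * (M : Matrix (Fin 2) (Fin 2) ℝ) 1 0 = 1 := by
  rw [← det_fin_two]
  exact M.det_coe

theorem specialLinear_det_eq_complex :
    ((M : Matrix (Fin 2) (Fin 2) ℝ) 0 0 : ℂ) * ((M : Matrix (Fin 2) (Fin 2) ℝ) 1 1 : ℂ)
      - ((M : Matrix (Fin 2) (Fin 2) ℝ) 0 1 : ℂ) * ((M : Matrix (Fin 2) (Fin 2) ℝ) 1 0 : ℂ) = 1 := by
  exact_mod_cast congrArg (fun x : ℝ => (x : ℂ)) (specialLinear_det_eq M)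

theorem moebiusDenom_ne_zero (hz : 0 < z.im) : moebiusDenom M z ≠ 0 := by
  intro h
  have h1 := congrArg Complex.im h
  have h2 := congrArg Complex.re h
  simp only [moebiusDenom, add_im, mul_im, ofReal_re, ofReal_im, zero_mul, add_zero, zero_im,
    mul_eq_zero, hz.ne', or_false] at h1
  simp only [moebiusDenom, add_re, mul_re, ofReal_re, ofReal_im, zero_mul, h1, sub_zero, zero_re,
    zero_add] at h2
  have := specialLinear_det_eq M
  rw [h1, h2] at this
  simp at this

theorem moebius_eq (N : Matrix (Fin 2) (Fin 2) ℝ) (z : ℂ) :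
    moebius N z = ((N 0 0 : ℂ) * z + (N 0 1 : ℂ)) / moebiusDenom N z := rfl

theorem moebius_im : (moebius M z).im = z.im / normSq (moebiusDenom M z) := by
  have h : (((M : Matrix (Fin 2) (Fin 2) ℝ) 0 0 : ℂ) * z + (M : Matrix (Fin 2) (Fin 2) ℝ) 0 1).im
      * (moebiusDenom M z).re
      - (((M : Matrix (Fin 2) (Fin 2) ℝ) 0 0 : ℂ) * z + (M : Matrix (Fin 2) (Fin 2) ℝ) 0 1).re
      * (moebiusDenom M z).im = z.im := by
    simp only [moebiusDenom, add_im, mul_im, ofReal_re, ofReal_im, add_re, mul_re]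
    linear_combination z.im * specialLinear_det_eq M
  rw [moebius_eq, div_im, ← sub_div, h]

theorem moebius_im_pos (hz : 0 < z.im) : 0 < (moebius M z).im := by
  rw [moebius_im]
  exact div_pos hz (normSq_pos.2 (moebiusDenom_ne_zero M hz))

/-- Gives both preservation of distinctness and, with `moebius_im`, the invariance of `|z - w|²/(Im
z Im w)`. -/
theorem moebius_sub (hz : 0 < z.im) (hw : 0 < w.im) :
    moebius M z - moebius M w = (z - w) / (moebiusDenom M z * moebiusDenom M w) := by
  have h1 := moebiusDenom_ne_zero M hz
  have h2 := moebiusDenom_ne_zero M hw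
  rw [moebius_eq, moebius_eq, div_sub_div _ _ h1 h2]
  congr 1
  simp only [moebiusDenom]
  linear_combination (z - w) * specialLinear_det_eq_complex M

theorem moebius_mul (M N : SpecialLinearGroup (Fin 2) ℝ) (hz : 0 < z.im) :
    moebius ((M : Matrix (Fin 2) (Fin 2) ℝ) * (N : Matrix (Fin 2) (Fin 2) ℝ)) z
      = moebius M (moebius N z) := by
  have h1 := moebiusDenom_ne_zero N hz
  have h2 := moebiusDenom_ne_zero M (moebius_im_pos N hz)
  have h4 : moebiusDenom ((M : Matrix (Fin 2) (Fin 2) ℝ) * (N : Matrix (Fin 2) (Fin 2) ℝ)) z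
      = moebiusDenom M (moebius N z) * moebiusDenom N z := by
    rw [moebiusDenom.eq_1 _ (moebius N z), moebius_eq N]
    field_simp
    simp only [moebiusDenom, mul_apply, Fin.sum_univ_two]
    push_cast
    ring
  rw [moebius_eq, h4, moebius_eq M, div_eq_div_iff (mul_ne_zero h2 h1) h2]
  have h5 : moebius N z * moebiusDenom N z = (N : Matrix (Fin 2) (Fin 2) ℝ) 0 0 * z
      + (N : Matrix (Fin 2) (Fin 2) ℝ) 0 1 := by
    rw [moebius_eq, div_mul_cancel₀ _ h1]
  have h6 : moebiusDenom N z = (N : Matrix (Fin 2) (Fin 2) ℝ) 1 0 * z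
      + (N : Matrix (Fin 2) (Fin 2) ℝ) 1 1 := rfl
  simp only [mul_apply, Fin.sum_univ_two]
  push_cast
  linear_combination (-(M : Matrix (Fin 2) (Fin 2) ℝ) 0 0 * moebiusDenom M (moebius N z)) * h5
    - ((M : Matrix (Fin 2) (Fin 2) ℝ) 0 1 * moebiusDenom M (moebius N z)) * h6

theorem pairAct_mul (M N : SpecialLinearGroup (Fin 2) ℝ) {p : CC} (hp : p ∈ pairSpace) :
    pairAct ((M * N : SpecialLinearGroup (Fin 2) ℝ)) p = pairAct M (pairAct N p) := by
  simp only [pairAct, ← moebius_mul M N hp.1, ← moebius_mul M N hp.2.1]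
  rfl

theorem pairAct_mem {p : CC} (hp : p ∈ pairSpace) : pairAct M p ∈ pairSpace := by
  refine ⟨moebius_im_pos M hp.1, moebius_im_pos M hp.2.1, ?_⟩
  simp only [pairAct]
  rw [← sub_ne_zero, moebius_sub M hp.1 hp.2.1]
  exact div_ne_zero (sub_ne_zero.2 hp.2.2)
    (mul_ne_zero (moebiusDenom_ne_zero M hp.1) (moebiusDenom_ne_zero M hp.2.1))

theorem pairAct_one (p : CC) :
    pairAct ((1 : SpecialLinearGroup (Fin 2) ℝ) : Matrix (Fin 2) (Fin 2) ℝ) p = p := by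
  simp [pairAct, moebius]

theorem hasDerivAt_moebius (hz : 0 < z.im) :
    HasDerivAt (moebius M) (1 / moebiusDenom M z ^ 2) z := by
  have h1 := moebiusDenom_ne_zero M hz
  have e1 := ((hasDerivAt_id z).const_mul ((M : Matrix (Fin 2) (Fin 2) ℝ) 0 0 : ℂ)).add_const
    ((M : Matrix (Fin 2) (Fin 2) ℝ) 0 1 : ℂ)
  have e2 := ((hasDerivAt_id z).const_mul ((M : Matrix (Fin 2) (Fin 2) ℝ) 1 0 : ℂ)).add_const
    ((M : Matrix (Fin 2) (Fin 2) ℝ) 1 1 : ℂ)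
  refine (e1.div e2 h1).congr_deriv ?_
  simp only [id]
  change _ / (moebiusDenom M z) ^ 2 = _
  congr 1
  linear_combination specialLinear_det_eq_complex M

/-- The derivative of the diagonal action. -/
def pairActDeriv (p u : CC) : CC :=
  (1 / moebiusDenom M p.1 ^ 2 * u.1, 1 / moebiusDenom M p.2 ^ 2 * u.2)

theorem hasFDerivAt_pairAct {p : CC} (hp : p ∈ pairSpace) :
    ∃ L : CC →L[ℝ] CC, HasFDerivAt (pairAct M) L p ∧ ∀ u, L u = pairActDeriv M p u := by
  have e1 := ((hasDerivAt_moebius M hp.1).hasFDerivAt.restrictScalars ℝ).comp p hasFDerivAt_fst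
  have e2 := ((hasDerivAt_moebius M hp.2.1).hasFDerivAt.restrictScalars ℝ).comp p hasFDerivAt_snd
  refine ⟨_, e1.prodMk e2, fun u => ?_⟩
  simp [pairActDeriv, mul_comm]

theorem fderiv_pairAct {p : CC} (hp : p ∈ pairSpace) (u : CC) :
    fderiv ℝ (pairAct M) p u = pairActDeriv M p u := by
  obtain ⟨L, hL, h⟩ := hasFDerivAt_pairAct M hp
  rw [hL.fderiv, h]

theorem hasDerivAt_pairAct_comp {c : ℝ → CC} {c' : CC} {t : ℝ} (hc : HasDerivAt c c' t)
    (hp : c t ∈ pairSpace) :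
    HasDerivAt (fun t => pairAct M (c t)) (pairActDeriv M (c t) c') t := by
  obtain ⟨L, hL, h⟩ := hasFDerivAt_pairAct M hp
  rw [← h]
  exact hL.comp_hasDerivAt t hc

theorem pairActDeriv_sum {p : CC} (a : Fin 4 → ℝ) (e : Fin 4 → CC) :
    pairActDeriv M p (∑ i, a i • e i) = ∑ i, a i • pairActDeriv M p (e i) := by
  ext1 <;> simp [pairActDeriv, Fin.sum_univ_four] <;> ring

theorem pairActDeriv_I_smul {p u : CC} :
    pairActDeriv M p (Complex.I • u) = Complex.I • pairActDeriv M p u := by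
  ext1 <;> simp [pairActDeriv] <;> ring

theorem basePoint_mem {s : ℝ} (hs : 0 < s) : basePoint s ∈ pairSpace := by
  refine ⟨?_, ?_, ?_⟩
  · simpa only [basePoint, I_mul_im, ofReal_re] using Real.exp_pos _
  · simpa only [basePoint, I_mul_im, ofReal_re] using Real.exp_pos _
  · simp only [basePoint, ne_eq, mul_eq_mul_left_iff, I_ne_zero, or_false, ofReal_inj,
      Real.exp_eq_exp]
    linarith

/-- The frame at the base point `w_s`. -/
def baseFrame (s : ℝ) : Fin 4 → CC :=
  ![(I * (Real.exp (s / 2) / 2 : ℝ), -(I * (Real.exp (-s / 2) / 2 : ℝ))),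
    ((1 + Real.exp s : ℝ), (1 + Real.exp (-s) : ℝ)),
    ((1 - Real.exp s : ℝ), (1 - Real.exp (-s) : ℝ)),
    (I * (2 * Real.exp (s / 2) : ℝ), I * (2 * Real.exp (-s / 2) : ℝ))]

theorem hasDerivAt_basePoint (s : ℝ) : HasDerivAt basePoint (baseFrame s 0) s := by
  have e1 : HasDerivAt (fun r : ℝ => Real.exp (r / 2)) (Real.exp (s / 2) / 2) s :=
    (((hasDerivAt_id s).div_const 2).exp).congr_deriv (by simp; ring)
  have e2 : HasDerivAt (fun r : ℝ => Real.exp (-r / 2)) (-(Real.exp (-s / 2) / 2)) s :=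
    (((hasDerivAt_id s).neg.div_const 2).exp).congr_deriv (by simp; ring)
  have h := (e1.ofReal_comp.const_mul I).prodMk (e2.ofReal_comp.const_mul I)
  refine h.congr_deriv ?_
  simp [baseFrame]

theorem frame_zero {s : ℝ} (hs : 0 < s) :
    frame s M 0 = pairActDeriv M (basePoint s) (baseFrame s 0) :=
  (hasDerivAt_pairAct_comp M (hasDerivAt_basePoint s) (basePoint_mem hs)).deriv

theorem hasDerivAt_matrix_exp_apply (X : Matrix (Fin 2) (Fin 2) ℝ) (i j : Fin 2) :
    HasDerivAt (fun t : ℝ => NormedSpace.exp (t • X) i j) (X i j) 0 := by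
  let _ := Matrix.linftyOpNormedRing (n := Fin 2) (α := ℝ)
  let _ := Matrix.linftyOpNormedAlgebra (n := Fin 2) (R := ℝ) (α := ℝ)
  have h := hasDerivAt_exp_smul_const (𝕂 := ℝ) X (0 : ℝ)
  simp only [zero_smul, NormedSpace.exp_zero, one_mul] at h
  exact (LinearMap.toContinuousLinearMap (Matrix.entryLinearMap ℝ ℝ i j)).hasFDerivAt.comp_hasDerivAt
    (0 : ℝ) h

/-- The matrix `X` generates the vector field `b + (a - d) z - c z²`, which is then pushed forward
by the derivative of `M`. -/
theorem hasDerivAt_moebius_mul_exp (X : Matrix (Fin 2) (Fin 2) ℝ) (hz : 0 < z.im) :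
    HasDerivAt (fun t : ℝ => moebius ((M : Matrix (Fin 2) (Fin 2) ℝ) * NormedSpace.exp (t • X)) z)
      (1 / moebiusDenom M z ^ 2 * (X 0 1 + (X 0 0 - X 1 1) * z - X 1 0 * z ^ 2)) 0 := by
  set m := (M : Matrix (Fin 2) (Fin 2) ℝ) with hm
  have he : ∀ i j, HasDerivAt (fun t : ℝ => (((m * NormedSpace.exp (t • X)) i j : ℝ) : ℂ))
      ((m * X) i j : ℝ) 0 := fun i j => by
    refine HasDerivAt.ofReal_comp ?_
    simp only [mul_apply, Fin.sum_univ_two]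
    exact ((hasDerivAt_matrix_exp_apply X 0 j).const_mul _).add
      ((hasDerivAt_matrix_exp_apply X 1 j).const_mul _)
  have e1 := ((he 0 0).mul_const z).add (he 0 1)
  have e2 := ((he 1 0).mul_const z).add (he 1 1)
  have h0 : m * NormedSpace.exp ((0 : ℝ) • X) = m := by simp
  have hd : moebiusDenom m z ≠ 0 := moebiusDenom_ne_zero M hz
  refine (e1.div e2 (by simpa only [Pi.add_apply, h0, moebiusDenom] using hd)).congr_deriv ?_
  simp only [Pi.add_apply, h0]
  change _ / moebiusDenom m z ^ 2 = _
  rw [one_div, inv_mul_eq_div]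
  congr 1
  simp only [mul_apply, Fin.sum_univ_two]
  push_cast
  linear_combination ((X 0 1 : ℂ) + (X 0 0 - X 1 1) * z - X 1 0 * z ^ 2) *
    specialLinear_det_eq_complex M

theorem frame_succ {s : ℝ} (hs : 0 < s) (k : Fin 3) :
    frame s M k.succ = pairActDeriv M (basePoint s) (baseFrame s k.succ) := by
  have hp := basePoint_mem hs
  have h : frame s M k.succ = _ :=
    ((hasDerivAt_moebius_mul_exp M (lieBasis k) hp.1).prodMk
    (hasDerivAt_moebius_mul_exp M (lieBasis k) hp.2.1)).deriv
  rw [h]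
  have e1 : exp (s : ℂ) = exp ((s : ℂ) / 2) ^ 2 := by
    rw [← Complex.exp_nat_mul]; congr 1; push_cast; ring
  have e2 : exp (-(s : ℂ)) = exp (-(s : ℂ) / 2) ^ 2 := by
    rw [← Complex.exp_nat_mul]; congr 1; push_cast; ring
  simp only [pairActDeriv]
  fin_cases k <;> simp [lieBasis, baseFrame, basePoint, e1, e2, mul_pow] <;>
    refine ⟨Or.inl ?_, Or.inl ?_⟩ <;> ring

theorem frame_eq {s : ℝ} (hs : 0 < s) (i : Fin 4) :
    frame s M i = pairActDeriv M (basePoint s) (baseFrame s i) :=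
  Fin.cases (frame_zero M hs) (frame_succ M hs) i

theorem sum_smul_frame {s : ℝ} (hs : 0 < s) (a : Fin 4 → ℝ) :
    ∑ i, a i • frame s M i = pairActDeriv M (basePoint s) (∑ i, a i • baseFrame s i) := by
  simp only [frame_eq M hs, pairActDeriv_sum]

theorem pairAct_inv_pairAct {p : CC} (hp : p ∈ pairSpace) :
    pairAct (M⁻¹ : SpecialLinearGroup (Fin 2) ℝ) (pairAct M p) = p := by
  rw [← pairAct_mul _ _ hp, inv_mul_cancel, pairAct_one]

theorem exists_moebius_I (hz : 0 < z.im) :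
    ∃ M : SpecialLinearGroup (Fin 2) ℝ, moebius M I = z := by
  have hy : 0 < √z.im := Real.sqrt_pos.2 hz
  refine ⟨⟨!![√z.im, z.re / √z.im; 0, 1 / √z.im], ?_⟩, ?_⟩
  · rw [det_fin_two_of]
    field_simp
    simp
  · have h2 : ((√z.im : ℝ) : ℂ) ≠ 0 := by exact_mod_cast hy.ne'
    have h3 : ((√z.im : ℝ) : ℂ) * (√z.im : ℝ) = (z.im : ℂ) := by
      rw [← ofReal_mul, Real.mul_self_sqrt hz.le]
    simp only [moebius, of_apply, cons_val', cons_val_zero, cons_val_one, cons_val_fin_one]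
    push_cast
    field_simp
    conv_rhs => rw [← re_add_im z]
    linear_combination I * h3

/-- A rotation about `i` moves any point of the half plane to the imaginary axis. -/
theorem exists_rotation (z : ℂ) :
    ∃ M : SpecialLinearGroup (Fin 2) ℝ, moebius M I = I ∧ (moebius M z).re = 0 := by
  -- Up to a positive denominator this is the real part of the image of `z` under rotation by `θ`.
  -- Its values at `0` and `π/2` are opposite, so it vanishes somewhere.
  let f : ℝ → ℝ := fun θ => z.re * (Real.cos θ ^ 2 - Real.sin θ ^ 2)
    + (1 - normSq z) * (Real.sin θ * Real.cos θ)
  have hf : Continuous f := by fun_prop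
  obtain ⟨θ, hθ⟩ : ∃ θ, f θ = 0 := by
    refine mem_range_of_exists_le_of_exists_ge hf ?_ ?_
    · rcases le_total z.re 0 with h | h
      · exact ⟨0, by simpa [f] using h⟩
      · exact ⟨Real.pi / 2, by simpa [f] using h⟩
    · rcases le_total z.re 0 with h | h
      · exact ⟨Real.pi / 2, by simpa [f] using h⟩
      · exact ⟨0, by simpa [f] using h⟩
  let R : SpecialLinearGroup (Fin 2) ℝ := ⟨!![Real.cos θ, Real.sin θ; -Real.sin θ, Real.cos θ], by
    rw [det_fin_two_of]
    nlinarith [Real.sin_sq_add_cos_sq θ]⟩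
  refine ⟨R, ?_, ?_⟩
  · have h1 : moebiusDenom R I ≠ 0 := moebiusDenom_ne_zero R (by simp)
    rw [moebius_eq, div_eq_iff h1]
    simp only [R, moebiusDenom, of_apply, cons_val', cons_val_zero, cons_val_one, cons_val_fin_one]
    push_cast
    linear_combination (sin (θ : ℂ)) * I_mul_I
  · rw [moebius_eq, div_re, ← add_div, div_eq_zero_iff]
    left
    simp only [R, moebiusDenom, of_apply, cons_val', cons_val_zero, cons_val_one, cons_val_fin_one,
      add_re, add_im, mul_re, mul_im, ofReal_re, ofReal_im]
    refine Eq.trans ?_ hθ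
    simp only [f, normSq_apply]
    ring

theorem pairAct_exp_basePoint (s : ℝ) :
    ∃ M : SpecialLinearGroup (Fin 2) ℝ, pairAct M (basePoint s) = (I, I * (Real.exp (-s) : ℂ)) := by
  refine ⟨⟨!![Real.exp (-s / 4), 0; 0, Real.exp (s / 4)], ?_⟩, ?_⟩
  · rw [det_fin_two_of, ← Real.exp_add]
    ring_nf; simp
  · have h : (Real.exp (s / 4) : ℂ) ≠ 0 := by exact_mod_cast (Real.exp_pos _).ne'
    simp only [pairAct, moebius, basePoint, of_apply, cons_val', cons_val_zero, cons_val_one,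
      cons_val_fin_one, ofReal_zero, zero_mul, zero_add, add_zero]
    ext1 <;> simp only <;> rw [div_eq_iff h]
    · rw [mul_left_comm, ← ofReal_mul, ← Real.exp_add]
      ring_nf
    · rw [mul_left_comm, mul_assoc, ← ofReal_mul, ← Real.exp_add, ← ofReal_mul, ← Real.exp_add]
      ring_nf

/-- Every pair of distinct points is equivalent to some `w_s`. -/
theorem exists_pairAct_basePoint {p : CC} (hp : p ∈ pairSpace) :
    ∃ s : ℝ, 0 < s ∧ ∃ M : SpecialLinearGroup (Fin 2) ℝ, pairAct M (basePoint s) = p := by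
  have hred : ∀ (N : SpecialLinearGroup (Fin 2) ℝ) {p : CC}, p ∈ pairSpace →
      (∃ s : ℝ, 0 < s ∧ ∃ M : SpecialLinearGroup (Fin 2) ℝ, pairAct M (basePoint s) = pairAct N p) →
      ∃ s : ℝ, 0 < s ∧ ∃ M : SpecialLinearGroup (Fin 2) ℝ, pairAct M (basePoint s) = p := by
    rintro N p hp ⟨s, hs, M, hM⟩
    refine ⟨s, hs, N⁻¹ * M, ?_⟩
    rw [pairAct_mul _ _ (basePoint_mem hs), hM, pairAct_inv_pairAct N hp]
  have hlt : ∀ t : ℝ, 0 < t → t < 1 → ∃ s : ℝ, 0 < s ∧ ∃ M : SpecialLinearGroup (Fin 2) ℝ,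
      pairAct M (basePoint s) = (I, I * (t : ℂ)) := fun t h0 h1 => by
    obtain ⟨M, hM⟩ := pairAct_exp_basePoint (-Real.log t)
    refine ⟨-Real.log t, neg_pos.2 (Real.log_neg h0 h1), M, ?_⟩
    rw [hM, neg_neg, Real.exp_log h0]
  have haxis : ∀ t : ℝ, (I, I * (t : ℂ)) ∈ pairSpace → ∃ s : ℝ, 0 < s ∧
      ∃ M : SpecialLinearGroup (Fin 2) ℝ, pairAct M (basePoint s) = (I, I * (t : ℂ)) := fun t ht => by
    have h0 : 0 < t := by simpa using ht.2.1
    have h1 : t ≠ 1 := fun h => ht.2.2 (by simp [h])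
    rcases lt_or_gt_of_ne h1 with h | h
    · exact hlt t h0 h
    -- `z ↦ -1/z` fixes `i` and inverts `t`, so the swap is not needed to reach `s > 0`.
    · let S : SpecialLinearGroup (Fin 2) ℝ := ⟨!![0, 1; -1, 0], by simp [det_fin_two_of]⟩
      have hS : pairAct S (I, I * (t : ℂ)) = (I, I * ((t⁻¹ : ℝ) : ℂ)) := by
        have ht' : (t : ℂ) ≠ 0 := by exact_mod_cast h0.ne'
        simp only [S, pairAct, moebius, of_apply, cons_val', cons_val_zero, cons_val_one,
          cons_val_fin_one]
        push_cast
        ext1 <;> simp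
        field_simp
      refine hred S ht ?_
      rw [hS]
      exact hlt _ (inv_pos.2 h0) (inv_lt_one_of_one_lt₀ h)
  obtain ⟨N, hN⟩ := exists_moebius_I hp.1
  have hq := pairAct_mem N⁻¹ hp
  have hq1 : (pairAct (N⁻¹ : SpecialLinearGroup (Fin 2) ℝ) p).1 = I := by
    -- The second point is arbitrary; it only places `i` in an admissible pair.
    have hI : ((I, 2 * I) : CC) ∈ pairSpace := ⟨by simp, by simp, by simp [eq_comm]⟩
    have := congrArg Prod.fst (pairAct_inv_pairAct N hI)
    simp only [pairAct, hN] at this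
    exact this
  refine hred N⁻¹ hp ?_
  set q := pairAct (N⁻¹ : SpecialLinearGroup (Fin 2) ℝ) p
  obtain ⟨R, hR, hR2⟩ := exists_rotation q.2
  have hRq : pairAct R q = (I, I * ((moebius R q.2).im : ℂ)) := by
    simp only [pairAct, hq1, hR]
    congr 1
    conv_lhs => rw [← re_add_im (moebius R q.2), hR2]
    simp [mul_comm]
  refine hred R hq ?_
  have := pairAct_mem R hq
  rw [hRq] at this ⊢
  exact haxis _ this

end Moebius

/-! ### Invariant Kähler metrics along the curve of base points. -/

section Invariant

open Matrix Complex

/-- With `x = e^{s/2}`, identities at `w_s` become rational identities in `x`. -/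
theorem exp_half_facts (s : ℝ) :
    ∃ x : ℝ, 0 < x ∧ Real.exp (s / 2) = x ∧ Real.exp (-s / 2) = x⁻¹ ∧ Real.exp s = x ^ 2 ∧
      Real.exp (-s) = (x ^ 2)⁻¹ ∧ Real.cosh (s / 2) = (x + x⁻¹) / 2 ∧
      Real.sinh (s / 2) = (x - x⁻¹) / 2 := by
  have h2 : Real.exp s = Real.exp (s / 2) ^ 2 := by
    rw [← Real.exp_nat_mul]; congr 1; push_cast; ring
  refine ⟨Real.exp (s / 2), Real.exp_pos _, rfl, ?_, h2, ?_, ?_, ?_⟩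
  · rw [neg_div, Real.exp_neg]
  · rw [Real.exp_neg, h2]
  · rw [Real.cosh_eq, Real.exp_neg]
  · rw [Real.sinh_eq, Real.exp_neg]

theorem sinh_half_pos {s : ℝ} (hs : 0 < s) : 0 < Real.sinh (s / 2) :=
  Real.sinh_pos_iff.2 (by positivity)

theorem I_smul_baseFrame_one (s : ℝ) :
    I • baseFrame s 1 = Real.cosh (s / 2) • baseFrame s 3 := by
  obtain ⟨x, hx, h1, h2, h3, h4, h5, h6⟩ := exp_half_facts s
  have hx' : (x : ℂ) ≠ 0 := by exact_mod_cast hx.ne'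
  simp only [baseFrame, h1, h2, h3, h4, h5, cons_val, Prod.smul_mk, smul_eq_mul, real_smul]
  push_cast
  ext1 <;> simp only <;> field_simp
  ring

theorem I_smul_baseFrame_two (s : ℝ) :
    I • baseFrame s 2 = (-4 * Real.sinh (s / 2)) • baseFrame s 0 := by
  obtain ⟨x, hx, h1, h2, h3, h4, h5, h6⟩ := exp_half_facts s
  have hx' : (x : ℂ) ≠ 0 := by exact_mod_cast hx.ne'
  simp only [baseFrame, h1, h2, h3, h4, h6, cons_val, Prod.smul_mk, smul_eq_mul, real_smul]
  push_cast
  ext1 <;> simp only <;> field_simp <;> ring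

theorem I_smul_baseFrame_zero {s : ℝ} (hs : 0 < s) :
    I • baseFrame s 0 = (1 / (4 * Real.sinh (s / 2))) • baseFrame s 2 := by
  have h := sinh_half_pos hs
  have h1 := congrArg (fun v => (-(1 / (4 * Real.sinh (s / 2)))) • (I • v))
    (I_smul_baseFrame_two s)
  simp only [smul_comm I (_ : ℝ), smul_smul, I_mul_I, neg_smul, one_smul, smul_neg, neg_neg] at h1
  rw [h1, show -(1 / (4 * Real.sinh (s / 2))) * (-4 * Real.sinh (s / 2)) = 1 by
    field_simp, one_smul]

theorem I_smul_baseFrame_three (s : ℝ) :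
    I • baseFrame s 3 = (-(1 / Real.cosh (s / 2))) • baseFrame s 1 := by
  have h := Real.cosh_pos (s / 2)
  have h1 := congrArg (fun v => ((1 / Real.cosh (s / 2))) • (I • v)) (I_smul_baseFrame_one s)
  simp only [smul_comm I (_ : ℝ), smul_smul, I_mul_I, neg_smul, one_smul, smul_neg] at h1
  rw [neg_smul, h1, show 1 / Real.cosh (s / 2) * Real.cosh (s / 2) = 1 by
    field_simp, one_smul]

variable {γ : CC → Bilin}

theorem IsGInvariant.apply_pairAct (hG : IsGInvariant γ) (M : SpecialLinearGroup (Fin 2) ℝ)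
    {p : CC} (hp : p ∈ pairSpace) (u v : CC) :
    γ (pairAct M p) (pairActDeriv M p u) (pairActDeriv M p v) = γ p u v := by
  have := hG.moebius M p hp u v
  rwa [fderiv_pairAct M hp, fderiv_pairAct M hp] at this

/-- The invariance under the element of `G` which fixes the base points. -/
theorem IsGInvariant.apply_isotropy (hG : IsGInvariant γ) {s : ℝ} (hs : 0 < s) (u v : CC) :
    γ (basePoint s) (-((Real.exp s : ℂ) * u.2), -((Real.exp (-s) : ℂ) * u.1))
      (-((Real.exp s : ℂ) * v.2), -((Real.exp (-s) : ℂ) * v.1)) = γ (basePoint s) u v := by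
  have hp := basePoint_mem hs
  let S : SpecialLinearGroup (Fin 2) ℝ := ⟨!![0, 1; -1, 0], by simp [det_fin_two_of]⟩
  obtain ⟨x, hx, h1, h2, h3, h4, -, -⟩ := exp_half_facts s
  have hx' : (x : ℂ) ≠ 0 := by exact_mod_cast hx.ne'
  -- `z ↦ -1/z` exchanges the two points of `w_s`, so following it by the swap fixes `w_s`.
  have hS : pairAct S (basePoint s) = (basePoint s).swap := by
    simp only [S, pairAct, _root_.moebius, basePoint, h1, h2, of_apply, cons_val', cons_val_zero,
      cons_val_one, cons_val_fin_one]
    push_cast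
    ext1 <;> simp [mul_comm]
  have hd : ∀ u, (pairActDeriv S (basePoint s) u).swap
      = (-((Real.exp s : ℂ) * u.2), -((Real.exp (-s) : ℂ) * u.1)) := fun u => by
    simp only [S, pairActDeriv, moebiusDenom, basePoint, h1, h2, h3, h4, of_apply, cons_val',
      cons_val_zero, cons_val_one, cons_val_fin_one]
    push_cast
    ext1 <;> simp [mul_pow]
  have hf : ∀ q u : CC, fderiv ℝ (Prod.swap : CC → CC) q u = u.swap := fun q u => by
    have : HasFDerivAt (Prod.swap : CC → CC)
      ((ContinuousLinearMap.snd ℝ ℂ ℂ).prod (ContinuousLinearMap.fst ℝ ℂ ℂ)) q :=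
      ((ContinuousLinearMap.snd ℝ ℂ ℂ).prod (ContinuousLinearMap.fst ℝ ℂ ℂ)).hasFDerivAt
    rw [this.fderiv]; rfl
  have e1 := hG.apply_pairAct S hp u v
  have e2 := hG.swap _ (pairAct_mem S hp) (pairActDeriv S (basePoint s) u)
    (pairActDeriv S (basePoint s) v)
  rw [hf, hf, hd, hd, hS, Prod.swap_swap] at e2
  rw [e2, ← e1, hS]

/-- The sign by which the isotropy involution acts on the frame. -/
def frameSign : Fin 4 → ℝ := ![1, -1, 1, -1]

theorem isotropy_baseFrame (s : ℝ) (i : Fin 4) :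
    ((-((Real.exp s : ℂ) * (baseFrame s i).2), -((Real.exp (-s) : ℂ) * (baseFrame s i).1)) : CC)
      = frameSign i • baseFrame s i := by
  obtain ⟨x, hx, h1, h2, h3, h4, -, -⟩ := exp_half_facts s
  have hx' : (x : ℂ) ≠ 0 := by exact_mod_cast hx.ne'
  fin_cases i <;> simp only [frameSign, baseFrame, h1, h2, h3, h4] <;> ext1 <;> simp <;>
    field_simp <;> ring

theorem IsGInvariant.hasDiagonalForm (hG : IsGInvariant γ) {B : Fin 4 → ℝ → ℝ}
    (h : ∀ s, 0 < s → ∀ i j, γ (basePoint s) (baseFrame s i) (baseFrame s j)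
      = if i = j then B i s else 0) :
    HasDiagonalForm (fun p u v => γ p u v) B := by
  intro s hs M a b
  change γ _ _ _ = _
  rw [sum_smul_frame M hs, sum_smul_frame M hs, hG.apply_pairAct M (basePoint_mem hs)]
  simp only [map_sum, map_smul, _root_.sum_apply, _root_.smul_apply, smul_eq_mul, h s hs]
  refine Finset.sum_congr rfl fun i _ => ?_
  simp only [Finset.mul_sum]
  rw [Finset.sum_eq_single i (fun j _ hj => by simp [hj]) (by simp)]
  simp; ring

theorem HasDiagonalForm.baseFrame_apply {B : Fin 4 → ℝ → ℝ}
    (h : HasDiagonalForm (fun p u v => γ p u v) B) {s : ℝ} (hs : 0 < s) (i j : Fin 4) :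
    γ (basePoint s) (baseFrame s i) (baseFrame s j) = if i = j then B i s else 0 := by
  have h1 := h s hs 1 (Pi.single i 1) (Pi.single j 1)
  have h2 : ∀ u, pairActDeriv (1 : SpecialLinearGroup (Fin 2) ℝ) (basePoint s) u = u := fun u => by simp [pairActDeriv, moebiusDenom]
  simp only [pairAct_one, frame_eq _ hs, h2] at h1
  by_cases hij : i = j
  · subst hij
    simpa [Pi.single_apply] using h1
  · simpa [Pi.single_apply, hij, Ne.symm hij] using h1

theorem IsKahlerMetric.apply_I_smul (hK : IsKahlerMetric γ) {p : CC} (hp : p ∈ pairSpace)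
    (u v : CC) : γ p (I • u) v = -γ p u (I • v) := by
  have := hK.hermitian p hp u (I • v)
  rw [smul_smul, I_mul_I, neg_one_smul, map_neg] at this
  linarith

theorem IsKahlerMetric.apply_I_smul_self (hK : IsKahlerMetric γ) {p : CC} (hp : p ∈ pairSpace)
    (u : CC) : γ p u (I • u) = 0 := by
  have h1 := hK.apply_I_smul hp u u
  have h2 := hK.symm p hp u (I • u)
  linarith

theorem IsGInvariant.baseFrame_apply_of_sign (hG : IsGInvariant γ) {s : ℝ} (hs : 0 < s)
    {i j : Fin 4} (hij : frameSign i * frameSign j = -1) :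
    γ (basePoint s) (baseFrame s i) (baseFrame s j) = 0 := by
  have h := hG.apply_isotropy hs (baseFrame s i) (baseFrame s j)
  rw [isotropy_baseFrame, isotropy_baseFrame] at h
  simp only [map_smul, _root_.smul_apply, smul_eq_mul] at h
  rw [← mul_assoc, mul_comm (frameSign j), hij] at h
  linarith

/-- The value of an invariant Kähler metric on the frame at a base point. -/
theorem IsKahlerMetric.baseFrame_apply (hK : IsKahlerMetric γ) (hG : IsGInvariant γ) {s : ℝ}
    (hs : 0 < s) (i j : Fin 4) :
    γ (basePoint s) (baseFrame s i) (baseFrame s j) = if i = j then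
      ![γ (basePoint s) (baseFrame s 2) (baseFrame s 2) / (16 * Real.sinh (s / 2) ^ 2),
        γ (basePoint s) (baseFrame s 1) (baseFrame s 1),
        γ (basePoint s) (baseFrame s 2) (baseFrame s 2),
        γ (basePoint s) (baseFrame s 1) (baseFrame s 1) / Real.cosh (s / 2) ^ 2] i else 0 := by
  have hp := basePoint_mem hs
  have hsinh := sinh_half_pos hs
  have hcosh := Real.cosh_pos (s / 2)
  have h00 : γ (basePoint s) (baseFrame s 0) (baseFrame s 0)
      = γ (basePoint s) (baseFrame s 2) (baseFrame s 2) / (16 * Real.sinh (s / 2) ^ 2) := by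
    have := hK.hermitian _ hp (baseFrame s 2) (baseFrame s 2)
    rw [I_smul_baseFrame_two] at this
    simp only [map_smul, _root_.smul_apply, smul_eq_mul] at this
    rw [← this]
    field_simp
    ring
  have h33 : γ (basePoint s) (baseFrame s 3) (baseFrame s 3)
      = γ (basePoint s) (baseFrame s 1) (baseFrame s 1) / Real.cosh (s / 2) ^ 2 := by
    have := hK.hermitian _ hp (baseFrame s 1) (baseFrame s 1)
    rw [I_smul_baseFrame_one] at this
    simp only [map_smul, _root_.smul_apply, smul_eq_mul] at this
    rw [← this]
    field_simp
  have h20 : γ (basePoint s) (baseFrame s 2) (baseFrame s 0) = 0 := by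
    have := hK.apply_I_smul_self hp (baseFrame s 2)
    rw [I_smul_baseFrame_two] at this
    simpa [hsinh.ne'] using this
  have h13 : γ (basePoint s) (baseFrame s 1) (baseFrame s 3) = 0 := by
    have := hK.apply_I_smul_self hp (baseFrame s 1)
    rw [I_smul_baseFrame_one] at this
    simpa [hcosh.ne'] using this
  have h02 := hK.symm _ hp (baseFrame s 0) (baseFrame s 2)
  have h31 := hK.symm _ hp (baseFrame s 3) (baseFrame s 1)
  rw [h20] at h02
  rw [h13] at h31
  -- The remaining off-diagonal pairs have opposite isotropy signs.
  have hz : ∀ {i j : Fin 4}, frameSign i * frameSign j = -1 →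
    γ (basePoint s) (baseFrame s i) (baseFrame s j) = 0 := hG.baseFrame_apply_of_sign hs
  fin_cases i <;> fin_cases j <;>
    first
    | exact h00
    | exact h33
    | exact rfl
    | exact h20
    | exact h02
    | exact h13
    | exact h31
    | exact hz (by simp [frameSign])

/-- Translations and dilations suffice for the ODE: their differentials are scalars, so invariance
directly gives the derivatives of `γ` along `(1, 1)` and along the position vector. -/
theorem IsGInvariant.apply_translate (hG : IsGInvariant γ) {p : CC} (hp : p ∈ pairSpace) (t : ℝ)
    (u v : CC) : γ (p + t • (1, 1)) u v = γ p u v := by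
  let N : SpecialLinearGroup (Fin 2) ℝ := ⟨!![1, t; 0, 1], by simp [det_fin_two_of]⟩
  have h := hG.apply_pairAct N hp u v
  have h1 : pairAct N p = p + t • (1, 1) := by
    ext1 <;> simp [N, pairAct, _root_.moebius]
  have h2 : ∀ u, pairActDeriv N p u = u := fun u => by
    simp [N, pairActDeriv, moebiusDenom]
  rwa [h1, h2, h2] at h

theorem IsGInvariant.apply_dilate (hG : IsGInvariant γ) {p : CC} (hp : p ∈ pairSpace) (t : ℝ)
    (u v : CC) : γ (Real.exp t • p) u v = Real.exp (-2 * t) * γ p u v := by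
  let N : SpecialLinearGroup (Fin 2) ℝ := ⟨!![Real.exp (t / 2), 0; 0, Real.exp (-t / 2)], by
    rw [det_fin_two_of, ← Real.exp_add]
    ring_nf
    simp⟩
  have h := hG.apply_pairAct N hp u v
  obtain ⟨x, hx, e1, e2, e3, e4, -, -⟩ := exp_half_facts t
  have hx' : (x : ℂ) ≠ 0 := by exact_mod_cast hx.ne'
  have h1 : pairAct N p = Real.exp t • p := by
    ext1 <;> simp only [N, pairAct, _root_.moebius, e1, e2, e3, of_apply, cons_val', cons_val_zero,
      cons_val_one, cons_val_fin_one, Prod.smul_fst, Prod.smul_snd, real_smul] <;>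
      push_cast <;> field_simp <;> ring
  have h2 : ∀ u, pairActDeriv N p u = Real.exp t • u := fun u => by
    ext1 <;> simp only [N, pairActDeriv, moebiusDenom, e1, e2, e3, of_apply, cons_val',
      cons_val_zero, cons_val_one, cons_val_fin_one, Prod.smul_fst, Prod.smul_snd, real_smul] <;>
      push_cast <;> field_simp <;> ring
  rw [h1, h2, h2] at h
  simp only [map_smul, _root_.smul_apply, smul_eq_mul] at h
  rw [← h, ← mul_assoc, ← mul_assoc, ← Real.exp_add, ← Real.exp_add]
  ring_nf
  simp

theorem hasDerivAt_bilin_comp {c : ℝ → CC} {c' p : CC} {t : ℝ} (h : DifferentiableAt ℝ γ p)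
    (hc : HasDerivAt c c' t) (hp : c t = p) (u v : CC) :
    HasDerivAt (fun t => γ (c t) u v) (fderiv ℝ γ p c' u v) t := by
  subst hp
  have e1 : HasFDerivAt (fun q => γ q u v) (((fderiv ℝ γ (c t)).flip u).flip v) (c t) := by
    refine ((h.hasFDerivAt.clm_apply (hasFDerivAt_const u _)).clm_apply
      (hasFDerivAt_const v _)).congr_fderiv ?_
    ext v <;> simp
  exact e1.comp_hasDerivAt t hc

theorem IsGInvariant.fderiv_translate (hG : IsGInvariant γ) {p : CC} (hp : p ∈ pairSpace)
    (hd : DifferentiableAt ℝ γ p) (u v : CC) : fderiv ℝ γ p (1, 1) u v = 0 := by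
  have e1 : HasDerivAt (fun t : ℝ => p + t • ((1, 1) : CC)) (1, 1) 0 := by
    simpa using ((hasDerivAt_id (0 : ℝ)).smul_const ((1, 1) : CC)).const_add p
  have e2 := hasDerivAt_bilin_comp hd e1 (by simp) u v
  simp only [hG.apply_translate hp] at e2
  exact e2.unique (hasDerivAt_const _ _)

theorem IsGInvariant.fderiv_dilate (hG : IsGInvariant γ) {p : CC} (hp : p ∈ pairSpace)
    (hd : DifferentiableAt ℝ γ p) (u v : CC) : fderiv ℝ γ p p u v = -2 * γ p u v := by
  have e1 : HasDerivAt (fun t : ℝ => Real.exp t • p) p 0 := by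
    simpa using (Real.hasDerivAt_exp (0 : ℝ)).smul_const p
  have e2 := hasDerivAt_bilin_comp hd e1 (by simp) u v
  simp only [hG.apply_dilate hp] at e2
  have e4 : HasDerivAt (fun t : ℝ => Real.exp (-2 * t) * γ p u v) (-2 * γ p u v) 0 := by
    have := (((hasDerivAt_id (0 : ℝ)).const_mul (-2)).exp).mul_const (γ p u v)
    simpa using this
  exact e2.unique e4

theorem IsKahlerMetric.hasDerivAt_apply_div_cosh (hK : IsKahlerMetric γ) (hG : IsGInvariant γ)
    {s : ℝ} (hs : 0 < s) :
    HasDerivAt (fun r => γ (basePoint r) (baseFrame r 1) (baseFrame r 1) / Real.cosh (r / 2))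
      (γ (basePoint s) (baseFrame s 2) (baseFrame s 2) / (2 * Real.sinh (s / 2))) s := by
  have hp := basePoint_mem hs
  have hd := (hK.differentiableAt hp).hasFDerivAt
  set g' := fderiv ℝ γ (basePoint s)
  let T : CC := (1, 1)
  have hT := hG.fderiv_translate hp (hK.differentiableAt hp)
  have hR := hG.fderiv_dilate hp (hK.differentiableAt hp)
  -- Use the constant vectors equal at `w_s` to `∂/∂s`, `T = ½(e₁ + e₂)` and `w_s = ½ e₃`.
  -- Invariance makes the `T` derivative zero and the `w_s` derivative `-2γ`, so only the derivative
  -- along `s` is unknown.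
  have hclosed := hK.fderiv_closed hp (baseFrame s 0) T (basePoint s)
  rw [hT] at hclosed
  change g' _ _ _ + _ + g' _ _ _ = 0 at hclosed
  rw [hR, add_zero] at hclosed
  have e1 := ((hd.comp_hasDerivAt s (hasDerivAt_basePoint s)).clm_apply
    (hasDerivAt_const s (I • T))).clm_apply (hasDerivAt_basePoint s)
  have hTr : ∀ r, T = (1 / 2 : ℝ) • (baseFrame r 1 + baseFrame r 2) := fun r => by
    ext1 <;> simp [T, baseFrame] <;> ring
  have hwr : ∀ r, basePoint r = (1 / 2 : ℝ) • baseFrame r 3 := fun r => by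
    ext1 <;> simp [basePoint, baseFrame] <;> ring
  -- On the curve, `γ(JT, w_r)` is one quarter of `γ(e₁, e₁)/cosh(r/2)`. Since `w_r` also moves, its
  -- derivative has the extra term `γ(JT, ∂/∂s)`.
  have e2 : HasDerivAt (fun r => 4 * γ (basePoint r) (I • T) (basePoint r)) _ s :=
    e1.const_mul 4
  have e3 := e2.congr_of_eventuallyEq (f₁ := fun r =>
      γ (basePoint r) (baseFrame r 1) (baseFrame r 1) / Real.cosh (r / 2)) (by
    filter_upwards [lt_mem_nhds hs] with r hr
    have hb := hK.baseFrame_apply hG hr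
    have hc := Real.cosh_pos (r / 2)
    have : γ (basePoint r) (I • T) (basePoint r) = γ (basePoint r) (I • T)
      ((1 / 2 : ℝ) • baseFrame r 3) := by rw [← hwr]
    rw [this, hTr r, smul_comm, smul_add, I_smul_baseFrame_one, I_smul_baseFrame_two]
    simp only [map_smul, map_add, _root_.add_apply, _root_.smul_apply, smul_eq_mul, hb 3 3, hb 0 3]
    simp
    field_simp
    ring)
  refine e3.congr_deriv ?_
  have hb := hK.baseFrame_apply hG hs
  have hsinh := sinh_half_pos hs
  have h2 : γ (basePoint s) (complexJ (baseFrame s 0)) T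
      = γ (basePoint s) (baseFrame s 2) (baseFrame s 2) / (8 * Real.sinh (s / 2)) := by
    rw [complexJ_apply, I_smul_baseFrame_zero hs, hTr s]
    simp only [map_smul, map_add, _root_.smul_apply, smul_eq_mul, hb 2 1]
    simp
    field_simp
    ring
  have h3 : γ (basePoint s) (I • T) (baseFrame s 0)
      = - γ (basePoint s) (complexJ (baseFrame s 0)) T := by
    rw [hK.apply_I_smul hp, hK.symm _ hp]; rfl
  have h4 : g' (baseFrame s 0) (I • T) (basePoint s)
      = 2 * γ (basePoint s) (complexJ (baseFrame s 0)) T := by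
    have h5 : g' (baseFrame s 0) (complexJ T) (basePoint s)
      = g' (baseFrame s 0) (I • T) (basePoint s) := rfl
    linarith
  simp
  rw [h4, h3, h2]
  field_simp
  ring

theorem contDiffOn_apply_baseFrame_one (hγ : ContDiffOn ℝ ∞ γ pairSpace) :
    ContDiffOn ℝ ∞ (fun s => γ (basePoint s) (baseFrame s 1) (baseFrame s 1)) (Set.Ioi 0) := by
  have h0 : ContDiff ℝ ∞ (fun x : ℝ => (x : ℂ)) := ofRealCLM.contDiff
  have h1 : ContDiff ℝ ∞ basePoint := by
    unfold basePoint
    exact (contDiff_const.mul (h0.comp (by fun_prop))).prodMk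
      (contDiff_const.mul (h0.comp (by fun_prop)))
  have h2 : ContDiff ℝ ∞ (fun s => baseFrame s 1) :=
    (h0.comp (by fun_prop : ContDiff ℝ ∞ fun s : ℝ => 1 + Real.exp s)).prodMk
      (h0.comp (by fun_prop : ContDiff ℝ ∞ fun s : ℝ => 1 + Real.exp (-s)))
  exact ((hγ.comp h1.contDiffOn fun s hs => basePoint_mem hs).clm_apply h2.contDiffOn).clm_apply
    h2.contDiffOn

theorem IsKahlerMetric.exists_hasDiagonalForm (hK : IsKahlerMetric γ) (hG : IsGInvariant γ) :
    ∃ A : ℝ → ℝ, ContDiffOn ℝ ∞ A (Set.Ioi 0) ∧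
      HasDiagonalForm (fun p u v => γ p u v) (coeffs A) := by
  -- The witness is `A(s) = γ(e₁, e₁)` at `w_s`.
  refine ⟨_, contDiffOn_apply_baseFrame_one hK.smooth, hG.hasDiagonalForm fun s hs i j => ?_⟩
  rw [hK.baseFrame_apply hG hs]
  have hsinh := sinh_half_pos hs
  congr 1
  fin_cases i
  · simp [coeffs, (hK.hasDerivAt_apply_div_cosh hG hs).deriv]
    field_simp
    ring
  · rfl
  · simp [coeffs, (hK.hasDerivAt_apply_div_cosh hG hs).deriv]
    field_simp
  · rfl

end Invariant

/-! ### The hyperbolic reference metric, the volume density and the invariant `ℓ`. -/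

section Hyperbolic

open Matrix Complex

/-- The product of the hyperbolic metrics of the two factors. -/
def hypMetric (p : CC) : Bilin :=
  (1 / p.1.im ^ 2) • ((coordL 0).smulRight (coordL 0) + (coordL 1).smulRight (coordL 1))
    + (1 / p.2.im ^ 2) • ((coordL 2).smulRight (coordL 2) + (coordL 3).smulRight (coordL 3))

theorem hypMetric_apply (p u v : CC) :
    hypMetric p u v = (u.1.re * v.1.re + u.1.im * v.1.im) / p.1.im ^ 2
      + (u.2.re * v.2.re + u.2.im * v.2.im) / p.2.im ^ 2 := by
  simp [hypMetric, coordL_apply, coords]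
  ring

/-- Tangent vectors scale by the inverse square of the denominator and `Im z` by the inverse of its
squared modulus, so the quotient is unchanged. -/
theorem hypMetric_pairAct (M : SpecialLinearGroup (Fin 2) ℝ) {p : CC} (hp : p ∈ pairSpace)
    (u v : CC) :
    hypMetric (pairAct M p) (pairActDeriv M p u) (pairActDeriv M p v) = hypMetric p u v := by
  have key : ∀ z a b : ℂ, 0 < z.im →
      ((1 / moebiusDenom M z ^ 2 * a).re * (1 / moebiusDenom M z ^ 2 * b).re
        + (1 / moebiusDenom M z ^ 2 * a).im * (1 / moebiusDenom M z ^ 2 * b).im)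
        / (moebius M z).im ^ 2 = (a.re * b.re + a.im * b.im) / z.im ^ 2 := by
    intro z a b hz
    have h1 := moebiusDenom_ne_zero M hz
    have h2 : normSq (moebiusDenom M z) ≠ 0 := (normSq_pos.2 h1).ne'
    have h3 : ∀ c : ℂ, (c * a).re * (c * b).re + (c * a).im * (c * b).im
        = normSq c * (a.re * b.re + a.im * b.im) := fun c => by
      simp only [mul_re, mul_im, normSq_apply]; ring
    rw [h3, moebius_im, map_div₀, map_one, map_pow]
    field_simp
  simp only [hypMetric_apply, pairActDeriv, pairAct]
  rw [key _ _ _ hp.1, key _ _ _ hp.2.1]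

/-- The coefficients of the product of the hyperbolic metrics. -/
def hypCoeffs : Fin 4 → ℝ → ℝ :=
  ![fun _ => 1 / 2, fun s => 8 * Real.cosh (s / 2) ^ 2, fun s => 8 * Real.sinh (s / 2) ^ 2,
    fun _ => 8]

theorem hypMetric_baseFrame (s : ℝ) (i j : Fin 4) :
    hypMetric (basePoint s) (baseFrame s i) (baseFrame s j) = if i = j then hypCoeffs i s else 0 := by
  obtain ⟨x, hx, h1, h2, h3, h4, h5, h6⟩ := exp_half_facts s
  rw [hypMetric_apply]
  simp only [hypCoeffs, baseFrame, basePoint, h1, h2, h3, h4]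
  fin_cases i <;> fin_cases j <;>
    simp [h5, h6, -ofReal_pow, -ofReal_add, -ofReal_sub, -ofReal_inv, -ofReal_mul] <;>
    field_simp <;> ring

/-- The matrix of the frame in the coordinates. -/
def frameMatrix (s : ℝ) (M : SpecialLinearGroup (Fin 2) ℝ) : Matrix (Fin 4) (Fin 4) ℝ :=
  Matrix.of fun i j => coords (pairActDeriv M (basePoint s) (baseFrame s j)) i

theorem apply_eq_sum_gram (γ : CC → Bilin) (p u v : CC) :
    γ p u v = ∑ l, ∑ k, coords u k * _root_.gram γ p k l * coords v l := by
  conv_lhs => rw [← sum_coords_smul u, ← sum_coords_smul v]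
  simp only [map_sum, map_smul, _root_.sum_apply, _root_.smul_apply, smul_eq_mul, Finset.mul_sum,
    _root_.gram, of_apply]
  refine Finset.sum_congr rfl fun k _ => Finset.sum_congr rfl fun l _ => ?_
  ring

theorem frameMatrix_mul_gram (γ : CC → Bilin) {s : ℝ} (M : SpecialLinearGroup (Fin 2) ℝ)
    {b : Fin 4 → ℝ}
    (h : ∀ i j, γ (pairAct M (basePoint s)) (pairActDeriv M (basePoint s) (baseFrame s i))
      (pairActDeriv M (basePoint s) (baseFrame s j)) = if i = j then b i else 0) :
    (frameMatrix s M)ᵀ * _root_.gram γ (pairAct M (basePoint s)) * frameMatrix s M = diagonal b := by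
  ext i j
  rw [diagonal_apply, ← h, apply_eq_sum_gram]
  simp only [mul_apply, Finset.sum_mul, transpose_apply, frameMatrix, of_apply]

theorem gram_hypMetric (p : CC) : _root_.gram hypMetric p
    = diagonal ![1 / p.1.im ^ 2, 1 / p.1.im ^ 2, 1 / p.2.im ^ 2, 1 / p.2.im ^ 2] := by
  ext i j
  simp only [_root_.gram, of_apply, hypMetric_apply, diagonal_apply]
  fin_cases i <;> fin_cases j <;> simp [coordVec]

/-- The volume density of an invariant metric. -/
theorem IsGInvariant.det_gram {γ : CC → Bilin} (hG : IsGInvariant γ) {s : ℝ} (hs : 0 < s)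
    (M : SpecialLinearGroup (Fin 2) ℝ) {b : Fin 4 → ℝ}
    (h : ∀ i j, γ (basePoint s) (baseFrame s i) (baseFrame s j) = if i = j then b i else 0) :
    (_root_.gram γ (pairAct M (basePoint s))).det
      * (256 * Real.cosh (s / 2) ^ 2 * Real.sinh (s / 2) ^ 2)
      = b 0 * b 1 * b 2 * b 3
        / ((pairAct M (basePoint s)).1.im ^ 4 * (pairAct M (basePoint s)).2.im ^ 4) := by
  have hp := basePoint_mem hs
  have e1 := congrArg Matrix.det (frameMatrix_mul_gram γ M (b := b) fun i j => by
    rw [hG.apply_pairAct M hp, h])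
  -- The same frame diagonalises `hypMetric`, whose determinant is known in coordinates; comparison
  -- eliminates the frame determinant. The factor `256 cosh² sinh²` is the product of the hyperbolic
  -- coefficients.
  have e2 := congrArg Matrix.det (frameMatrix_mul_gram hypMetric (s := s) M
    (b := fun i => hypCoeffs i s) fun i j => by rw [hypMetric_pairAct M hp, hypMetric_baseFrame])
  rw [det_mul, det_mul, det_transpose, det_diagonal] at e1 e2
  rw [gram_hypMetric, det_diagonal] at e2
  simp [Fin.prod_univ_four, hypCoeffs] at e1 e2
  have hM := pairAct_mem M hp
  have h1 := hM.1
  have h2 := hM.2.1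
  set q := pairAct M (basePoint s)
  set d := (frameMatrix s M).det
  rw [← e1, show 256 * Real.cosh (s / 2) ^ 2 * Real.sinh (s / 2) ^ 2
    = 2⁻¹ * (8 * Real.cosh (s / 2) ^ 2) * (8 * Real.sinh (s / 2) ^ 2) * 8 by ring, ← e2]
  field_simp

/-! ### The distance function -/

/-- The invariant `log (|z₁ - z₂|² / (Im z₁ Im z₂))`. -/
def logRatio (p : CC) : ℝ :=
  Real.log (normSq (p.1 - p.2)) - Real.log p.1.im - Real.log p.2.im

/-- The differential of `logRatio`. -/
def logRatioDeriv (p v : CC) : ℝ :=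
  (2 * (v.1 - v.2) / (p.1 - p.2)).re - v.1.im / p.1.im - v.2.im / p.2.im

theorem hasFDerivAt_log_im_fst {p : CC} (hp : p ∈ pairSpace) :
    HasFDerivAt (fun q : CC => Real.log q.1.im)
      ((p.1.im)⁻¹ • (imCLM ∘L ContinuousLinearMap.fst ℝ ℂ ℂ)) p :=
  ((imCLM ∘L ContinuousLinearMap.fst ℝ ℂ ℂ).hasFDerivAt (x := p)).log hp.1.ne'

theorem hasFDerivAt_log_im_snd {p : CC} (hp : p ∈ pairSpace) :
    HasFDerivAt (fun q : CC => Real.log q.2.im)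
      ((p.2.im)⁻¹ • (imCLM ∘L ContinuousLinearMap.snd ℝ ℂ ℂ)) p :=
  ((imCLM ∘L ContinuousLinearMap.snd ℝ ℂ ℂ).hasFDerivAt (x := p)).log hp.2.1.ne'

theorem hasFDerivAt_logRatio {p : CC} (hp : p ∈ pairSpace) :
    ∃ L : CC →L[ℝ] ℝ, HasFDerivAt logRatio L p ∧ ∀ v, L v = logRatioDeriv p v := by
  have hne : p.1 - p.2 ≠ 0 := sub_ne_zero.2 hp.2.2
  let D : CC →L[ℝ] ℂ := ContinuousLinearMap.fst ℝ ℂ ℂ - ContinuousLinearMap.snd ℝ ℂ ℂ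
  have e1 := (reCLM ∘L D).hasFDerivAt (x := p)
  have e2 := (imCLM ∘L D).hasFDerivAt (x := p)
  have hn : (reCLM ∘L D) p * (reCLM ∘L D) p + (imCLM ∘L D) p * (imCLM ∘L D) p ≠ 0 := by
    have := (normSq_pos.2 hne).ne'
    rw [normSq_apply] at this
    exact this
  have e3 := ((e1.mul e1).add (e2.mul e2)).log hn
  have e4 := (e3.sub (hasFDerivAt_log_im_fst hp)).sub (hasFDerivAt_log_im_snd hp)
  refine ⟨_, e4, fun v => ?_⟩
  have hn' : (p.1.re - p.2.re) ^ 2 + (p.1.im - p.2.im) ^ 2 ≠ 0 := by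
    have := (normSq_pos.2 hne).ne'
    rw [normSq_apply] at this
    simpa [sq] using this
  simp [logRatioDeriv, D, div_re, normSq_apply, ← sq]
  field_simp
  ring

/-- The first term comes from a holomorphic function: it is the real part of a complex bilinear form
and changes sign under `(u, v) ↦ (iu, iv)`. -/
theorem hasFDerivAt_logRatioDeriv {p : CC} (hp : p ∈ pairSpace) (v : CC) :
    ∃ L : CC →L[ℝ] ℝ, HasFDerivAt (fun q => logRatioDeriv q v) L p ∧ ∀ u,
      L u = -(2 * (v.1 - v.2) * (u.1 - u.2) / (p.1 - p.2) ^ 2).re + v.1.im * u.1.im / p.1.im ^ 2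
        + v.2.im * u.2.im / p.2.im ^ 2 := by
  have hne : p.1 - p.2 ≠ 0 := sub_ne_zero.2 hp.2.2
  let D : CC →L[ℝ] ℂ := ContinuousLinearMap.fst ℝ ℂ ℂ - ContinuousLinearMap.snd ℝ ℂ ℂ
  have e1 : HasDerivAt (fun z : ℂ => 2 * (v.1 - v.2) / z)
      (-(2 * (v.1 - v.2)) / (p.1 - p.2) ^ 2) (D p) := by
    have := (hasDerivAt_inv hne).const_mul (2 * (v.1 - v.2))
    refine this.congr_deriv ?_
    ring
  have e2 := reCLM.hasFDerivAt.comp p ((e1.hasFDerivAt.restrictScalars ℝ).comp p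
    (D.hasFDerivAt (x := p)))
  have e3 := (((hasDerivAt_inv hp.1.ne').const_mul v.1.im).hasFDerivAt).comp p
    ((imCLM ∘L ContinuousLinearMap.fst ℝ ℂ ℂ).hasFDerivAt (x := p))
  have e4 := (((hasDerivAt_inv hp.2.1.ne').const_mul v.2.im).hasFDerivAt).comp p
    ((imCLM ∘L ContinuousLinearMap.snd ℝ ℂ ℂ).hasFDerivAt (x := p))
  refine ⟨_, (e2.sub e3).sub e4, fun u => ?_⟩
  have : (u.1 - u.2) * (-(2 * (v.1 - v.2)) / (p.1 - p.2) ^ 2)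
      = -(2 * (v.1 - v.2) * (u.1 - u.2) / (p.1 - p.2) ^ 2) := by ring
  have h := congrArg Complex.re this
  simp only [mul_re, sub_re, sub_im, neg_re] at h
  simp [D]
  linear_combination h

theorem logRatio_pairAct (M : SpecialLinearGroup (Fin 2) ℝ) {p : CC} (hp : p ∈ pairSpace) :
    logRatio (pairAct M p) = logRatio p := by
  have h1 := normSq_pos.2 (moebiusDenom_ne_zero M hp.1)
  have h2 := normSq_pos.2 (moebiusDenom_ne_zero M hp.2.1)
  have h3 := normSq_pos.2 (sub_ne_zero.2 hp.2.2)
  simp only [logRatio, pairAct]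
  rw [moebius_sub M hp.1 hp.2.1, moebius_im, moebius_im, map_div₀, map_mul,
    Real.log_div h3.ne' (by positivity), Real.log_mul h1.ne' h2.ne',
    Real.log_div hp.1.ne' h1.ne', Real.log_div hp.2.1.ne' h2.ne']
  ring

theorem logRatioDeriv_pairAct (M : SpecialLinearGroup (Fin 2) ℝ) {p : CC} (hp : p ∈ pairSpace)
    (v : CC) : logRatioDeriv (pairAct M p) (pairActDeriv M p v) = logRatioDeriv p v := by
  obtain ⟨L, hL, hL'⟩ := hasFDerivAt_logRatio hp
  obtain ⟨N, hN, hN'⟩ := hasFDerivAt_logRatio (pairAct_mem M hp)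
  obtain ⟨D, hD, hD'⟩ := hasFDerivAt_pairAct M hp
  have e1 := (hN.comp p hD).congr_of_eventuallyEq (f₁ := logRatio) (by
    filter_upwards [pairSpace_mem_nhds hp] with q hq using (logRatio_pairAct M hq).symm)
  have e2 := congrArg (fun F : CC →L[ℝ] ℝ => F v) (hL.unique e1)
  simp only [ContinuousLinearMap.comp_apply, hL', hN', hD'] at e2
  exact e2.symm

theorem logRatio_basePoint {s : ℝ} (hs : 0 < s) :
    logRatio (basePoint s) = Real.log (4 * Real.sinh (s / 2) ^ 2) := by
  have h := sinh_half_pos hs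
  obtain ⟨x, hx, h1, h2, -, -, -, h6⟩ := exp_half_facts s
  have hn : normSq ((basePoint s).1 - (basePoint s).2) = 4 * Real.sinh (s / 2) ^ 2 := by
    rw [h6]
    simp only [basePoint, h1, h2, ← mul_sub, ← ofReal_sub, map_mul, normSq_I, normSq_ofReal]
    ring
  rw [logRatio, hn]
  simp only [basePoint, h1, h2, I_mul_im, ofReal_re, Real.log_inv]
  ring

theorem logRatioDeriv_baseFrame {s : ℝ} (hs : 0 < s) (a : Fin 4 → ℝ) :
    logRatioDeriv (basePoint s) (∑ i, a i • baseFrame s i)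
      = Real.cosh (s / 2) / Real.sinh (s / 2) * a 0 := by
  have h := sinh_half_pos hs
  obtain ⟨x, hx, h1, h2, h3, h4, h5, h6⟩ := exp_half_facts s
  have hx1 : x ^ 2 - 1 ≠ 0 := by
    rw [h6] at h
    intro h0
    have : (x - x⁻¹) / 2 = (x ^ 2 - 1) / (2 * x) := by field_simp
    rw [this, h0] at h
    simp at h
  have hd : (basePoint s).1 - (basePoint s).2 = I * ((x - x⁻¹ : ℝ) : ℂ) := by
    simp only [basePoint, h1, h2]; push_cast; ring
  have hre : ∀ (z : ℂ) (y : ℝ), (z / (I * (y : ℂ))).re = z.im / y := fun z y => by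
    rw [← div_div, div_ofReal_re, div_I]
    simp
  rw [logRatioDeriv, hd, hre, h5, h6]
  simp [Fin.sum_univ_four, baseFrame, basePoint, h1, h2, h3, h4, -ofReal_pow, -ofReal_add,
    -ofReal_sub, -ofReal_inv, -ofReal_mul]
  field_simp
  ring

theorem logRatioDeriv_I_smul_baseFrame {s : ℝ} (hs : 0 < s) (a : Fin 4 → ℝ) :
    logRatioDeriv (basePoint s) (I • ∑ i, a i • baseFrame s i)
      = -4 * Real.cosh (s / 2) * a 2 := by
  have h := sinh_half_pos hs
  have h1 : I • ∑ i, a i • baseFrame s i = ∑ i, (![-4 * Real.sinh (s / 2) * a 2,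
      -(1 / Real.cosh (s / 2)) * a 3, 1 / (4 * Real.sinh (s / 2)) * a 0,
      Real.cosh (s / 2) * a 1] : Fin 4 → ℝ) i • baseFrame s i := by
    simp only [Fin.sum_univ_four, smul_add, smul_comm I (_ : ℝ), I_smul_baseFrame_zero hs,
      I_smul_baseFrame_one, I_smul_baseFrame_two, I_smul_baseFrame_three, smul_smul, cons_val]
    simp only [mul_comm]
    abel
  rw [h1, logRatioDeriv_baseFrame hs]
  simp
  field_simp

end Hyperbolic

/-! ### Second derivatives of the logarithmic volume density. -/

section RadialVolume

open Matrix Complex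

variable {Φ : ℝ → ℝ} {f : CC → ℝ} {p : CC}

theorem fderiv_radial (hΦ : ContDiff ℝ ∞ Φ)
    (hf : ∀ q ∈ pairSpace, f q = Φ (logRatio q) - 4 * Real.log q.1.im - 4 * Real.log q.2.im)
    (hp : p ∈ pairSpace) (v : CC) :
    fderiv ℝ f p v = deriv Φ (logRatio p) * logRatioDeriv p v - 4 * (v.1.im * (p.1.im)⁻¹)
      - 4 * (v.2.im * (p.2.im)⁻¹) := by
  obtain ⟨L, hL, hL'⟩ := hasFDerivAt_logRatio hp
  have e0 := (hΦ.differentiable (by simp) (logRatio p)).hasDerivAt.comp_hasFDerivAt p hL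
  have e1 := (e0.sub ((hasFDerivAt_log_im_fst hp).const_mul 4)).sub
    ((hasFDerivAt_log_im_snd hp).const_mul 4)
  have e2 := e1.congr_of_eventuallyEq (f₁ := f) (by
    filter_upwards [pairSpace_mem_nhds hp] with q hq using hf q hq)
  rw [e2.fderiv]
  simp [hL']
  ring

theorem fderiv_fderiv_radial (hΦ : ContDiff ℝ ∞ Φ)
    (hf : ∀ q ∈ pairSpace, f q = Φ (logRatio q) - 4 * Real.log q.1.im - 4 * Real.log q.2.im)
    (hp : p ∈ pairSpace) (u v : CC) :
    fderiv ℝ (fun q => fderiv ℝ f q v) p u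
      = deriv (deriv Φ) (logRatio p) * (logRatioDeriv p u * logRatioDeriv p v)
        - deriv Φ (logRatio p) * (2 * (v.1 - v.2) * (u.1 - u.2) / (p.1 - p.2) ^ 2).re
        + (deriv Φ (logRatio p) + 4) * (v.1.im * u.1.im / p.1.im ^ 2 + v.2.im * u.2.im / p.2.im ^ 2)
      := by
  obtain ⟨L, hL, hL'⟩ := hasFDerivAt_logRatio hp
  obtain ⟨N, hN, hN'⟩ := hasFDerivAt_logRatioDeriv hp v
  have hΦ' : Differentiable ℝ (deriv Φ) :=
    ((contDiff_infty_iff_deriv.1 hΦ).2).differentiable (by simp)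
  have e0 := ((hΦ' (logRatio p)).hasDerivAt.comp_hasFDerivAt p hL).mul hN
  have e3 := (((hasDerivAt_inv hp.1.ne').const_mul v.1.im).comp_hasFDerivAt p
    ((imCLM ∘L ContinuousLinearMap.fst ℝ ℂ ℂ).hasFDerivAt (x := p))).const_mul 4
  have e4 := (((hasDerivAt_inv hp.2.1.ne').const_mul v.2.im).comp_hasFDerivAt p
    ((imCLM ∘L ContinuousLinearMap.snd ℝ ℂ ℂ).hasFDerivAt (x := p))).const_mul 4
  have e2 := ((e0.sub e3).sub e4).congr_of_eventuallyEq (f₁ := fun q => fderiv ℝ f q v) (by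
    filter_upwards [pairSpace_mem_nhds hp] with q hq using fderiv_radial hΦ hf hq v)
  rw [e2.fderiv]
  simp [hL', hN']
  ring

/-- The `J`-invariant part of the Hessian of a function of the distance plus the logarithm of the
hyperbolic volume density. -/
theorem hessian_radial (hΦ : ContDiff ℝ ∞ Φ)
    (hf : ∀ q ∈ pairSpace, f q = Φ (logRatio q) - 4 * Real.log q.1.im - 4 * Real.log q.2.im)
    (hp : p ∈ pairSpace) (u v : CC) :
    fderiv ℝ (fun q => fderiv ℝ f q v) p u
        + fderiv ℝ (fun q => fderiv ℝ f q (I • v)) p (I • u)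
      = deriv (deriv Φ) (logRatio p) * (logRatioDeriv p u * logRatioDeriv p v
          + logRatioDeriv p (I • u) * logRatioDeriv p (I • v))
        + (deriv Φ (logRatio p) + 4) * hypMetric p u v := by
  rw [fderiv_fderiv_radial hΦ hf hp, fderiv_fderiv_radial hΦ hf hp, hypMetric_apply]
  -- The holomorphic part cancels in the `J`-invariant sum, and the `y` terms complete to the
  -- hyperbolic metric.
  have h : 2 * ((I • v).1 - (I • v).2) * ((I • u).1 - (I • u).2) / (p.1 - p.2) ^ 2
      = -(2 * (v.1 - v.2) * (u.1 - u.2) / (p.1 - p.2) ^ 2) := by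
    simp only [Prod.smul_fst, Prod.smul_snd, smul_eq_mul]
    linear_combination (2 * (v.1 - v.2) * (u.1 - u.2) / (p.1 - p.2) ^ 2) * I_sq
  rw [h, neg_re]
  simp only [Prod.smul_fst, Prod.smul_snd, smul_eq_mul, I_mul_im]
  ring

end RadialVolume

/-! ### Smoothness of the coefficients and the ODE identity for `C`. -/

section Coefficients

theorem contDiffOn_cosh_half (S : Set ℝ) : ContDiffOn ℝ ∞ (fun s : ℝ => Real.cosh (s / 2)) S :=
  (Real.contDiff_cosh.comp (contDiff_id.div_const 2)).contDiffOn

theorem contDiffOn_sinh_half (S : Set ℝ) : ContDiffOn ℝ ∞ (fun s : ℝ => Real.sinh (s / 2)) S :=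
  (Real.contDiff_sinh.comp (contDiff_id.div_const 2)).contDiffOn

theorem contDiffOn_deriv_Ioi {F : ℝ → ℝ} (hF : ContDiffOn ℝ ∞ F (Set.Ioi 0)) :
    ContDiffOn ℝ ∞ (deriv F) (Set.Ioi 0) :=
  hF.deriv_of_isOpen isOpen_Ioi (by simp)

theorem contDiffOn_coeffs {B : ℝ → ℝ} (hB : ContDiffOn ℝ ∞ B (Set.Ioi 0)) (i : Fin 4) :
    ContDiffOn ℝ ∞ (coeffs B i) (Set.Ioi 0) := by
  have hd := contDiffOn_deriv_Ioi (hB.div (contDiffOn_cosh_half _)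
    fun s _ => (Real.cosh_pos (s / 2)).ne')
  have hs := contDiffOn_sinh_half (Set.Ioi 0)
  fin_cases i
  · exact (contDiffOn_const.div (contDiffOn_const.mul hs) fun s hs => by
      have := sinh_half_pos hs
      positivity).mul hd
  · exact hB
  · exact (contDiffOn_const.mul hs).mul hd
  · exact hB.div ((contDiffOn_cosh_half _).pow 2) fun s _ => by
      have := Real.cosh_pos (s / 2)
      positivity

/-- The parameter `s` as a function of the invariant `logRatio`. -/
def distOfLogRatio (r : ℝ) : ℝ := 2 * Real.arsinh (Real.exp (r / 2) / 2)

/-- Positivity on the whole line lets functions smooth only on `(0, ∞)` pull back to functions of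
`ℓ` smooth on all of `ℝ`. -/
theorem distOfLogRatio_pos (r : ℝ) : 0 < distOfLogRatio r := by
  have : 0 < Real.arsinh (Real.exp (r / 2) / 2) := Real.arsinh_pos_iff.2 (by positivity)
  unfold distOfLogRatio
  positivity

theorem contDiff_distOfLogRatio : ContDiff ℝ ∞ distOfLogRatio :=
  contDiff_const.mul (Real.contDiff_arsinh.comp
    ((Real.contDiff_exp.comp (contDiff_id.div_const 2)).div_const 2))

theorem distOfLogRatio_log {s : ℝ} (hs : 0 < s) :
    distOfLogRatio (Real.log (4 * Real.sinh (s / 2) ^ 2)) = s := by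
  have h := sinh_half_pos hs
  have h1 : Real.log (4 * Real.sinh (s / 2) ^ 2) / 2 = Real.log (2 * Real.sinh (s / 2)) := by
    rw [show 4 * Real.sinh (s / 2) ^ 2 = (2 * Real.sinh (s / 2)) ^ 2 by ring, Real.log_pow]
    push_cast; ring
  rw [distOfLogRatio, h1, Real.exp_log (by positivity), mul_div_cancel_left₀ _ two_ne_zero,
    Real.arsinh_sinh]
  ring

theorem hasDerivAt_log_sinh_sq {s : ℝ} (hs : 0 < s) :
    HasDerivAt (fun r : ℝ => Real.log (4 * Real.sinh (r / 2) ^ 2))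
      (Real.cosh (s / 2) / Real.sinh (s / 2)) s := by
  have h := sinh_half_pos hs
  have e := ((((hasDerivAt_id s).div_const 2).sinh.pow 2).const_mul 4).log (by simp; exact hs.ne')
  refine e.congr_deriv ?_
  simp
  field_simp

/-- The coefficients generated by a function of the form `-2 cosh² κ - 8 cosh²`. -/
theorem coeffs_eq_of_eq {C κ : ℝ → ℝ} {κ' s : ℝ} (hs : 0 < s)
    (hC : ∀ s, 0 < s → C s = -2 * Real.cosh (s / 2) ^ 2 * κ s - 8 * Real.cosh (s / 2) ^ 2)
    (hκ : HasDerivAt κ (κ' * (Real.cosh (s / 2) / Real.sinh (s / 2))) s) (a b : Fin 4 → ℝ) :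
    ∑ i, coeffs C i s * (a i * b i) = -(1 / 4) *
      (κ' * (Real.cosh (s / 2) / Real.sinh (s / 2) * a 0
          * (Real.cosh (s / 2) / Real.sinh (s / 2) * b 0)
          + -4 * Real.cosh (s / 2) * a 2 * (-4 * Real.cosh (s / 2) * b 2))
        + (κ s + 4) * ∑ i, hypCoeffs i s * (a i * b i)) := by
  have h := sinh_half_pos hs
  have hc := Real.cosh_pos (s / 2)
  have hcosh : HasDerivAt (fun r : ℝ => Real.cosh (r / 2)) (Real.sinh (s / 2) / 2) s :=
    (((hasDerivAt_id s).div_const 2).cosh).congr_deriv (by simp; ring)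
  -- For `r > 0`, `C/cosh = -2 cosh κ - 8 cosh`. In the application `κ = Φ'(ℓ)` and `κ' = Φ''(ℓ)`,
  -- with `coth(s/2) = dℓ/ds`.
  have e1 : HasDerivAt (fun r => C r / Real.cosh (r / 2))
      (-Real.sinh (s / 2) * κ s
        - 2 * Real.cosh (s / 2) * (κ' * (Real.cosh (s / 2) / Real.sinh (s / 2)))
        - 4 * Real.sinh (s / 2)) s := by
    have e2 := ((hcosh.const_mul (-2)).mul hκ).sub (hcosh.const_mul 8)
    refine (e2.congr_of_eventuallyEq ?_).congr_deriv (by ring)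
    filter_upwards [lt_mem_nhds hs] with r hr
    have hr' := Real.cosh_pos (r / 2)
    rw [hC r hr]
    simp
    field_simp
  simp [Fin.sum_univ_four, coeffs, hypCoeffs, e1.deriv, hC s hs]
  field_simp
  ring

end Coefficients

/-! ### Assembly of the Ricci formula. -/

section Ricci

open Matrix Complex

variable {γ : CC → Bilin}

theorem hasDiagonalForm_ricci (hK : IsKahlerMetric γ) (hG : IsGInvariant γ) {A : ℝ → ℝ}
    (hA : HasDiagonalForm (fun p u v => γ p u v) (coeffs A)) {C : ℝ → ℝ}
    (hC : ∀ s : ℝ, 0 < s →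
      C s = -4 * Real.sinh (s / 2) * Real.cosh (s / 2) *
          deriv (fun r => Real.log (coeffs A 0 r * coeffs A 1 r / Real.cosh (r / 2) ^ 2)) s
        - 8 * Real.cosh (s / 2) ^ 2) :
    (∀ i, ContDiffOn ℝ ∞ (coeffs C i) (Set.Ioi 0)) ∧ HasDiagonalForm (ricci γ) (coeffs C) := by
  -- On `(0, ∞)` the diagonal form forces `A = γ(e₁, e₁)`, hence smoothness.
  have hAs : ContDiffOn ℝ ∞ A (Set.Ioi 0) :=
    (contDiffOn_apply_baseFrame_one hK.smooth).congr fun s hs => by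
      rw [hA.baseFrame_apply hs]; rfl
  have hcoef : ∀ i, ContDiffOn ℝ ∞ (coeffs A i) (Set.Ioi 0) := contDiffOn_coeffs hAs
  have hpos : ∀ s, 0 < s → ∀ i, 0 < coeffs A i s := fun s hs i => by
    have h := hA.baseFrame_apply hs i i
    rw [if_pos rfl] at h
    rw [← h]
    refine hK.pos _ (basePoint_mem hs) _ fun h0 => ?_
    -- A frame vector cannot vanish, since its hyperbolic length is nonzero.
    have h1 := hypMetric_baseFrame s i i
    rw [h0, if_pos rfl] at h1
    have h2 := sinh_half_pos hs
    have h3 := Real.cosh_pos (s / 2)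
    fin_cases i <;> simp [hypCoeffs, h2.ne', h3.ne'] at h1
  set K : ℝ → ℝ := fun r => coeffs A 0 r * coeffs A 1 r / Real.cosh (r / 2) ^ 2 with hKdef
  have hKpos : ∀ s, 0 < s → 0 < K s := fun s hs => by
    have h1 := hpos s hs 0
    have h2 := hpos s hs 1
    have h3 := Real.cosh_pos (s / 2)
    simp only [hKdef]
    positivity
  have hKs : ContDiffOn ℝ ∞ (fun s => Real.log (K s)) (Set.Ioi 0) :=
    (((hcoef 0).mul (hcoef 1)).div ((contDiffOn_cosh_half _).pow 2) fun s _ => by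
      have := Real.cosh_pos (s / 2)
      positivity).log fun s hs => (hKpos s hs).ne'
  have hCs : ContDiffOn ℝ ∞ C (Set.Ioi 0) :=
    ((((contDiffOn_const.mul (contDiffOn_sinh_half _)).mul (contDiffOn_cosh_half _)).mul
      (contDiffOn_deriv_Ioi hKs)).sub
      (contDiffOn_const.mul ((contDiffOn_cosh_half _).pow 2))).congr fun s hs => hC s hs
  refine ⟨contDiffOn_coeffs hCs, ?_⟩
  -- From `A₃ = 16 sinh² A₁` and `A₄ = A₂/cosh²`, the product of the four coefficients over `256
  -- cosh² sinh²` is `K²/16`.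
  let Φ : ℝ → ℝ := fun r => 2 * Real.log (K (distOfLogRatio r)) - Real.log 16
  have hΦ : ContDiff ℝ ∞ Φ := by
    have := hKs.comp contDiff_distOfLogRatio.contDiffOn (s := Set.univ)
      fun r _ => distOfLogRatio_pos r
    exact (contDiff_const.mul (contDiffOn_univ.1 this)).sub contDiff_const
  have hf : ∀ q ∈ pairSpace, Real.log (_root_.gram γ q).det
      = Φ (logRatio q) - 4 * Real.log q.1.im - 4 * Real.log q.2.im := fun q hq => by
    obtain ⟨s, hs, M, rfl⟩ := exists_pairAct_basePoint hq
    have h1 := hG.det_gram hs M (hA.baseFrame_apply hs)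
    have h2 := sinh_half_pos hs
    have h3 := Real.cosh_pos (s / 2)
    have h4 : coeffs A 2 s = 16 * Real.sinh (s / 2) ^ 2 * coeffs A 0 s := by
      simp [coeffs]; field_simp; ring
    have h5 : coeffs A 3 s = coeffs A 1 s / Real.cosh (s / 2) ^ 2 := rfl
    have hy1 := hq.1
    have hy2 := hq.2.1
    rw [logRatio_pairAct M (basePoint_mem hs), logRatio_basePoint hs]
    simp only [Φ, distOfLogRatio_log hs]
    set q := pairAct M (basePoint s)
    have h6 : (_root_.gram γ q).det = K s ^ 2 / 16 / (q.1.im ^ 4 * q.2.im ^ 4) := by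
      have h7 : 256 * Real.cosh (s / 2) ^ 2 * Real.sinh (s / 2) ^ 2 ≠ 0 := by positivity
      rw [← mul_left_inj' h7, h1, h4, h5]
      simp only [hKdef]
      field_simp
      ring
    have hk := hKpos s hs
    rw [h6, Real.log_div (by positivity) (by positivity), Real.log_div (by positivity) (by norm_num),
      Real.log_mul (by positivity) (by positivity), Real.log_pow, Real.log_pow, Real.log_pow]
    push_cast
    ring
  let κ : ℝ → ℝ := fun s => deriv Φ (Real.log (4 * Real.sinh (s / 2) ^ 2))
  have hΦ' : Differentiable ℝ (deriv Φ) :=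
    ((contDiff_infty_iff_deriv.1 hΦ).2).differentiable (by simp)
  have hCκ : ∀ s, 0 < s →
      C s = -2 * Real.cosh (s / 2) ^ 2 * κ s - 8 * Real.cosh (s / 2) ^ 2 := fun s hs => by
    have h2 := sinh_half_pos hs
    -- Since `log K = ½(Φ(ℓ) + log 16)`, its `s` derivative is `½ κ coth(s/2)`, which turns `-4 sinh
    -- cosh` into `-2 cosh² κ`.
    have e1 := (hΦ.differentiable (by simp) _).hasDerivAt.comp s (hasDerivAt_log_sinh_sq hs)
    have e2 := ((e1.add_const (Real.log 16)).div_const 2).congr_of_eventuallyEq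
      (f₁ := fun s => Real.log (K s)) (by
        filter_upwards [lt_mem_nhds hs] with r hr
        simp [Φ, distOfLogRatio_log hr])
    rw [hC s hs, e2.deriv]
    simp only [κ]
    field_simp
    ring
  intro s hs M a b
  have hp := basePoint_mem hs
  have hq := pairAct_mem M hp
  have hκ : HasDerivAt κ (deriv (deriv Φ) (logRatio (basePoint s))
      * (Real.cosh (s / 2) / Real.sinh (s / 2))) s := by
    rw [logRatio_basePoint hs]
    exact (hΦ' _).hasDerivAt.comp s (hasDerivAt_log_sinh_sq hs)
  have hhyp : hypMetric (basePoint s) (∑ i, a i • baseFrame s i) (∑ i, b i • baseFrame s i)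
      = ∑ i, hypCoeffs i s * (a i * b i) := by
    simp only [map_sum, map_smul, _root_.sum_apply, _root_.smul_apply, smul_eq_mul,
      hypMetric_baseFrame]
    simp [Fin.sum_univ_four]
    ring
  rw [coeffs_eq_of_eq hs hCκ hκ, sum_smul_frame M hs, sum_smul_frame M hs, hK.ricci_eq hq,
    hessian_radial hΦ hf hq]
  simp only [← pairActDeriv_I_smul, logRatioDeriv_pairAct M hp, hypMetric_pairAct M hp,
    logRatio_pairAct M hp, logRatioDeriv_baseFrame hs, logRatioDeriv_I_smul_baseFrame hs, hhyp]
  rw [logRatio_basePoint hs]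

end Ricci

end

theorem proposition3p3 (γ : CC → Bilin) (hK : IsKahlerMetric γ) (hG : IsGInvariant γ) :
    (∃ A : ℝ → ℝ, ContDiffOn ℝ ∞ A (Set.Ioi 0) ∧
      HasDiagonalForm (fun p u v => γ p u v) (coeffs A)) ∧
    ∀ A : ℝ → ℝ, HasDiagonalForm (fun p u v => γ p u v) (coeffs A) →
      ∀ C : ℝ → ℝ,
        (∀ s : ℝ, 0 < s →
          C s = -4 * Real.sinh (s / 2) * Real.cosh (s / 2) *
              deriv (fun r => Real.log (coeffs A 0 r * coeffs A 1 r / Real.cosh (r / 2) ^ 2)) s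
            - 8 * Real.cosh (s / 2) ^ 2) →
        (∀ i, ContDiffOn ℝ ∞ (coeffs C i) (Set.Ioi 0)) ∧
        HasDiagonalForm (ricci γ) (coeffs C) :=
  ⟨hK.exists_hasDiagonalForm hG, fun _ hA _ hC => hasDiagonalForm_ricci hK hG hA hC⟩
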